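/- Let $m\ge 1$ and $n\ge 0$ be integers. Let $F$ be a field of characteristic zero with pairwise commuting derivations $\partial_1,\dots,\partial_m$ that are linearly independent over $F$; write $\partial=(\partial_1,\dots,\partial_m)^t$ and let $C=\{a\in F:\partial_i a=0 \text{ for all } i\}$ be the field of constants. Let $\mathbf{x}=(x_1,\dots,x_n)$ be a row of differentially independent $\partial$-indeterminates over $F$, let $F\langle\mathbf{x};\partial\rangle\supseteq C\langle\mathbf{x};\partial\rangle$ be the fields of $\partial$-differential rational functions in $\mathbf{x}$ over $F$ and over $C$, and put $$GL^{\partial}(m,F)=\{g\in GL(m,F):\ \partial_i g_{jk}=\partial_j g_{ik}\ \text{ for all } i,j,k\}.$$ For $f=f^{\partial}\langle\mathbf{x}\rangle\in C\langle\mathbf{x};\partial\rangle$, $g\in GL^{\partial}(m,F)$ and $h\in GL(n,C)$ let $f^{g^{-1}\partial}\langle\mathbf{x}h\rangle\in F\langle\mathbf{x};\partial\rangle$ be obtained from $f$ by replacing the derivations $\partial$ by $g^{-1}\partial$ and $\mathbf{x}$ by $\mathbf{x}h$. Let $H$ be a subgroup of $GL(n,C)$, and let $C\langle\mathbf{x};\partial\rangle^{(GL^{\partial}(m,F),H)}$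 be the set of all $f\in C\langle\mathbf{x};\partial\rangle$ with $f^{g^{-1}\partial}\langle\mathbf{x}h\rangle=f^{\partial}\langle\mathbf{x}\rangle$ for all $g\in GL^{\partial}(m,F)$ and $h\in H$. Suppose that $M=M^{\partial}\langle\mathbf{x}\rangle=(M_{ij})_{i,j=1}^m$ is a nonsingular matrix with entries in $C\langle\mathbf{x};\partial\rangle$ such that $\partial_k M_{ij}=\partial_i M_{kj}$ for all $i,j,k$ and $$M^{g^{-1}\partial}\langle\mathbf{x}h\rangle=g^{-1}M^{\partial}\langle\mathbf{x}\rangle\qquad\text{for all } g\in GL^{\partial}(m,F),\ h\in H.$$ Then the components $\delta_1,\dots,\delta_m$ of $\delta=M^{-1}\partial$ are pairwise commuting derivations of $C\langle\mathbf{x};\partial\rangle$, the set $C\langle\mathbf{x};\partial\rangle^{(GL^{\partial}(m,F),H)}$ is a subfield of $C\langle\mathbf{x};\partial\rangle$ containing $C$ and stable under $\delta_1,\dots,\delta_m$, one has $m\le n$, and $$\delta\text{-}\mathrm{tr.deg.}\; C\langle\mathbf{x};\partial\rangle^{(GL^{\partial}(m,F),H)}/C=n-m,$$ where the $\delta$-differential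 transcendence degree over $C$ is the largest number of elements that are $\delta$-algebraically independent over $C$. -/

import Mathlib

/-! Differential polynomials and differential rational functions in `n` indeterminates with
`m` commuting derivations, gauge transformations, and differential transcendence degree. -/

namespace DiffInv

noncomputable section

/-- The derivations of a commutative ring: the additive maps that satisfy the Leibniz rule. -/
abbrev Der (A : Type*) [CommRing A] : Type _ := Derivation ℤ A A

/-- A ring homomorphism `a ↦ a + ε D(a)` from `A` to the dual numbers over `A` is the same thing
as a derivation `D` of `A`. -/
def derivOfDual {A : Type*} [CommRing A] (φ : A →+* DualNumber A)
    (hφ : ∀ a, (φ a).fst = a) : Der A :=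
  Derivation.mk' (AddMonoidHom.toIntLinearMap
    { toFun := fun a => (φ a).snd
      map_zero' := by simp
      map_add' := fun a b => by simp }) (fun a b => by
        change (φ (a * b)).snd = a • (φ b).snd + b • (φ a).snd
        rw [map_mul, DualNumber.snd_mul, hφ, hφ, smul_eq_mul, smul_eq_mul, mul_comm b])

/-- The ring homomorphism `a ↦ j(a) + ε j(D(a))` attached to a derivation `D` of `A` and a ring
homomorphism `j : A → B`. -/
def dualOfDeriv {A B : Type*} [CommRing A] [CommRing B] (j : A →+* B) (D : Der A) :
    A →+* DualNumber B where
  toFun a := TrivSqZeroExt.inl (j a) + TrivSqZeroExt.inr (j (D a))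
  map_zero' := by simp
  map_one' := by simp
  map_add' a b := by ext <;> simp
  map_mul' a b := by
    ext
    · simp
    · simp [mul_comm]

theorem dualOfDeriv_snd {A B : Type*} [CommRing A] [CommRing B] (j : A →+* B) (D : Der A) (a : A) :
    (dualOfDeriv j D a).snd = j (D a) := by
  simp [dualOfDeriv]

/-- The ring `R{x₁,…,xₙ; ∂}` of differential polynomials: the polynomial ring over `R` in the
independent variables `∂^α x_i`, indexed by the pairs `(i, α)`. -/
abbrev DiffPoly (R : Type*) [CommRing R] (n m : ℕ) : Type _ :=
  MvPolynomial (Fin n × (Fin m → ℕ)) R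

/-- The field `R⟨x₁,…,xₙ; ∂⟩` of differential rational functions over the field `R`. -/
def DiffRat (R : Type*) [Field R] (n m : ℕ) : Type _ :=
  FractionRing (DiffPoly R n m)

instance (R : Type*) [Field R] (n m : ℕ) : Field (DiffRat R n m) :=
  inferInstanceAs (Field (FractionRing (DiffPoly R n m)))

instance (R : Type*) [Field R] (n m : ℕ) : Algebra (DiffPoly R n m) (DiffRat R n m) :=
  inferInstanceAs (Algebra (DiffPoly R n m) (FractionRing (DiffPoly R n m)))

instance (R : Type*) [Field R] (n m : ℕ) : IsFractionRing (DiffPoly R n m) (DiffRat R n m) :=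
  inferInstanceAs (IsFractionRing (DiffPoly R n m) (FractionRing (DiffPoly R n m)))

instance (R : Type*) [Field R] (n m : ℕ) : Algebra R (DiffRat R n m) :=
  ((algebraMap (DiffPoly R n m) (DiffRat R n m)).comp MvPolynomial.C).toAlgebra

instance (R : Type*) [Field R] (n m : ℕ) : IsScalarTower R (DiffPoly R n m) (DiffRat R n m) :=
  IsScalarTower.of_algebraMap_eq fun _ => rfl

/-- The variable `∂^α x_i` as a differential rational function. -/
def jet (R : Type*) [Field R] {n m : ℕ} (i : Fin n) (α : Fin m → ℕ) : DiffRat R n m :=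
  algebraMap (DiffPoly R n m) (DiffRat R n m) (MvPolynomial.X (i, α))

/-- The differential indeterminate `x_i`. -/
def indet (R : Type*) [Field R] {n m : ℕ} (i : Fin n) : DiffRat R n m := jet R i 0

section Derivations

variable {R : Type*} [Field R] {n m : ℕ}

/-- The homomorphism `p ↦ p + ε ∂_k p` on differential polynomials, where `∂_k` acts on the
coefficients as the given derivation and sends `∂^α x_i` to `∂^(α + e_k) x_i`. -/
def polyDual (D : Fin m → Der R) (k : Fin m) :
    DiffPoly R n m →+* DualNumber (DiffPoly R n m) :=
  MvPolynomial.eval₂Hom (dualOfDeriv MvPolynomial.C (D k)) fun p =>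
    TrivSqZeroExt.inl (MvPolynomial.X p) +
      TrivSqZeroExt.inr (MvPolynomial.X (p.1, p.2 + Pi.single k 1))

theorem polyDual_fst (D : Fin m → Der R) (k : Fin m) (p : DiffPoly R n m) :
    (polyDual D k p).fst = p := by
  induction p using MvPolynomial.induction_on with
  | C a => simp [polyDual, dualOfDeriv]
  | add p q hp hq => simp [hp, hq]
  | mul_X p i hp => simp [hp]; simp [polyDual]

/-- The derivation `∂_k` of the ring of differential polynomials. -/
def polyDeriv (D : Fin m → Der R) (k : Fin m) :
    Der (DiffPoly R n m) :=
  derivOfDual (polyDual D k) (polyDual_fst D k)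

theorem ratDual_isUnit (D : Fin m → Der R) (k : Fin m)
    (q : nonZeroDivisors (DiffPoly R n m)) :
    IsUnit (dualOfDeriv (algebraMap (DiffPoly R n m) (DiffRat R n m)) (polyDeriv D k) q) := by
  rw [TrivSqZeroExt.isUnit_iff_isUnit_fst]
  simp [dualOfDeriv]

/-- The homomorphism `f ↦ f + ε ∂_k f` on differential rational functions. -/
def ratDual (D : Fin m → Der R) (k : Fin m) :
    DiffRat R n m →+* DualNumber (DiffRat R n m) :=
  IsLocalization.lift (ratDual_isUnit D k)

theorem ratDual_fst (D : Fin m → Der R) (k : Fin m) (f : DiffRat R n m) :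
    (ratDual D k f).fst = f := by
  obtain ⟨p, q, hq, rfl⟩ := IsFractionRing.div_surjective (A := DiffPoly R n m) f
  have key : ∀ r : DiffPoly R n m,
      (ratDual D k (algebraMap _ _ r)).fst = algebraMap _ (DiffRat R n m) r := fun r => by
    rw [ratDual, IsLocalization.lift_eq]
    simp [dualOfDeriv]
  have hq' : algebraMap _ (DiffRat R n m) q ≠ 0 :=
    IsFractionRing.to_map_ne_zero_of_mem_nonZeroDivisors hq
  have h := congrArg (fun z => (ratDual D k z).fst)
    (div_mul_cancel₀ (algebraMap _ (DiffRat R n m) p) hq')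
  simp only [map_mul, TrivSqZeroExt.fst_mul, key] at h
  rw [eq_div_iff hq', h]

/-- The derivation `∂_k` of the field of differential rational functions: the extension of the
given derivation of `R` with `∂_k (∂^α x_i) = ∂^(α + e_k) x_i`. -/
def ratDeriv (D : Fin m → Der R) (k : Fin m) :
    Der (DiffRat R n m) :=
  derivOfDual (ratDual D k) (ratDual_fst D k)

theorem ratDeriv_algebraMap (D : Fin m → Der R) (k : Fin m) (a : R) :
    ratDeriv (n := n) D k (algebraMap R (DiffRat R n m) a) =
      algebraMap R (DiffRat R n m) (D k a) := by
  change (ratDual D k _).snd = _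
  rw [IsScalarTower.algebraMap_apply R (DiffPoly R n m) (DiffRat R n m), ratDual,
    IsLocalization.lift_eq,
    IsScalarTower.algebraMap_apply R (DiffPoly R n m) (DiffRat R n m)]
  have h : polyDeriv (n := n) D k (algebraMap R (DiffPoly R n m) a) =
      algebraMap R (DiffPoly R n m) (D k a) := by
    change (polyDual D k _).snd = _
    simp [polyDual, dualOfDeriv, MvPolynomial.algebraMap_eq]
  rw [dualOfDeriv_snd, h]

theorem ratDeriv_jet (D : Fin m → Der R) (k : Fin m) (i : Fin n) (α : Fin m → ℕ) :
    ratDeriv D k (jet R i α) = jet R i (α + Pi.single k 1) := by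
  change (ratDual D k _).snd = _
  rw [jet, ratDual, IsLocalization.lift_eq]
  have h : polyDeriv (n := n) D k (MvPolynomial.X (i, α)) =
      MvPolynomial.X (i, α + Pi.single k 1) := by
    change (polyDual D k _).snd = _
    simp [polyDual]
  rw [dualOfDeriv_snd, h, jet]

end Derivations

section General

variable {L : Type*} [Field L] {m : ℕ}

/-- The iterated operator `δ^α = δ₁^α₁ ∘ ⋯ ∘ δₘ^αₘ`. -/
def iter (δ : Fin m → Der L) (α : Fin m → ℕ) : Module.End ℤ L :=
  ((List.finRange m).map fun k => ((δ k : L →ₗ[ℤ] L) : Module.End ℤ L) ^ α k).prod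

/-- The system of derivations `A ∂`, that is `(A ∂)_i = ∑ j, A i j • ∂_j`. -/
def gauge (A : Matrix (Fin m) (Fin m) L) (D : Fin m → Der L) :
    Fin m → Der L :=
  fun i => ∑ j, A i j • D j

/-- A system of elements is `δ`-algebraically independent over `k` if no nonzero `δ`-differential
polynomial over `k` vanishes on it. -/
def DiffAlgIndep (k : Type*) [Field k] [Algebra k L] (δ : Fin m → Der L)
    {ι : Type*} (y : ι → L) : Prop :=
  AlgebraicIndependent k fun p : ι × (Fin m → ℕ) => iter δ p.2 (y p.1)

/-- The `δ`-differential transcendence degree over `k` of an intermediate field `K` of `L / k`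
(meant for `K` stable under `δ`, with `δ` vanishing on `k`): the supremum of the cardinalities of
the `δ`-algebraically independent subsets of `K`. -/
def diffTrdeg (k : Type*) [Field k] [Algebra k L] (δ : Fin m → Der L)
    (K : IntermediateField k L) : Cardinal :=
  ⨆ s : {s : Set L // s ⊆ (K : Set L) ∧ DiffAlgIndep k δ (fun a : s => (a : L))},
    Cardinal.mk s.1

end General

section Invariants

variable {F : Type*} [Field F] {m n : ℕ}

/-- The field of constants of a differential field. -/
def constField (D : Fin m → Der F) : Subfield F where
  carrier := {a | ∀ i, D i a = 0}
  mul_mem' ha hb i := by simp [ha i, hb i]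
  one_mem' i := by simp
  add_mem' ha hb i := by simp [ha i, hb i]
  zero_mem' i := by simp
  neg_mem' ha i := by simp [ha i]
  inv_mem' a ha i := by simp [Derivation.leibniz_inv, ha i]

/-- The set `GL^∂(m, F)` of the invertible matrices `g` with `∂_i g_jk = ∂_j g_ik`. -/
def GLd (D : Fin m → Der F) : Set (GL (Fin m) F) :=
  {g | ∀ i j k, D i (g j k) = D j (g i k)}

/-- The field `C⟨x; ∂⟩` of differential rational functions over the constants `C` of `F`. -/
abbrev CRat (D : Fin m → Der F) (n : ℕ) : Type _ := DiffRat (constField D) n m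

/-- The derivations `∂₁,…,∂ₘ` of `C⟨x; ∂⟩`; they vanish on `C`. -/
def cDeriv (D : Fin m → Der F) (n : ℕ) :
    Fin m → Der (CRat D n) :=
  ratDeriv (fun _ => 0)

/-- The system `δ = M⁻¹∂` of derivations of `C⟨x; ∂⟩`. -/
def invDeriv (D : Fin m → Der F) (M : Matrix (Fin m) (Fin m) (CRat D n)) :
    Fin m → Der (CRat D n) :=
  gauge M⁻¹ (cDeriv D n)

/-- The value `p^δ{y}` of a differential polynomial `p^∂{x}` over `C`: every `∂^α x_i` is
replaced by `δ^α y_i`. -/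
def polySubst (D : Fin m → Der F)
    (δ : Fin m → Der (DiffRat F n m)) (y : Fin n → DiffRat F n m) :
    DiffPoly (constField D) n m →+* DiffRat F n m :=
  MvPolynomial.eval₂Hom ((algebraMap F (DiffRat F n m)).comp (constField D).subtype)
    fun p => iter δ p.2 (y p.1)

/-- The value `f^δ⟨y⟩` in `F⟨x; ∂⟩` of a differential rational function `f^∂⟨x⟩` over `C`, computed
from its reduced fraction. It is used for `δ = g⁻¹∂` and `y = xh` with `g ∈ GL^∂(m, F)` and
`h ∈ GL(n, C)`; there `p ↦ p^δ{y}` is injective, so that the denominator does not vanish. -/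
def ratSubst (D : Fin m → Der F)
    (δ : Fin m → Der (DiffRat F n m)) (y : Fin n → DiffRat F n m)
    (f : CRat D n) : DiffRat F n m :=
  polySubst D δ y (IsFractionRing.num (DiffPoly (constField D) n m) f) /
    polySubst D δ y (IsFractionRing.den (DiffPoly (constField D) n m) f)

/-- The system `g⁻¹∂` of derivations of `F⟨x; ∂⟩`. -/
def gaugeInv (D : Fin m → Der F) (n : ℕ) (g : GL (Fin m) F) :
    Fin m → Der (DiffRat F n m) :=
  gauge (((g⁻¹ : GL (Fin m) F) : Matrix (Fin m) (Fin m) F).map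
    (algebraMap F (DiffRat F n m))) (ratDeriv D)

/-- The row vector `xh` over `F⟨x; ∂⟩`. -/
def rowMul (D : Fin m → Der F) (h : GL (Fin n) (constField D)) :
    Fin n → DiffRat F n m :=
  Matrix.vecMul (indet F)
    ((h : Matrix (Fin n) (Fin n) (constField D)).map
      ((algebraMap F (DiffRat F n m)).comp (constField D).subtype))

/-- `f` is `(GL^∂(m, F), H)`-invariant: `f^(g⁻¹∂)⟨xh⟩ = f^∂⟨x⟩` for all `g ∈ GL^∂(m, F)` and
`h ∈ H`. -/
def IsInvariant (D : Fin m → Der F) (H : Subgroup (GL (Fin n) (constField D)))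
    (f : CRat D n) : Prop :=
  ∀ g ∈ GLd D, ∀ h ∈ H,
    ratSubst D (gaugeInv D n g) (rowMul D h) f = ratSubst D (ratDeriv D) (indet F) f

end Invariants

end

end DiffInv

/-! Everything rests on counting jets. Let B(N) be the number of multi-indices of degree at most N,
a polynomial in N of degree m. If a·B(N) ≤ b·B(N+c) up to terms of lower order for all N, then a ≤ b
(`le_of_forall_card_multi_le`). Since the entries of M⁻¹ have finite order, δ^α f has order at most
|α| + c, so passing between ∂ and δ costs only a bounded shift of N. Closedness of the columns of M
makes the δ_i commute (`gauge_inv_comm`). Equivariance says that each substitution carries δ = M⁻¹∂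
to the same system M⁻¹∂ of F⟨x⟩ (`map_invDeriv`), hence δ preserves invariants.

Upper bound (`add_le_of_diffAlgIndep`). Invertible Jacobians (∂_i z_j) with z in F^m belong to GL^∂.
A nonzero differential polynomial does not vanish identically on F^m (`exists_eval_iter_ne_zero`),
so an ultrapower of F⟨x⟩ contains a generic z, differentially independent over F⟨x⟩, together with a
substitution φ : ∂ ↦ Z⁻¹∂, Z = (∂_i z_j), that fixes invariants (`exists_generic_substitution`).
From Z·φ(M) = M, the elements φ(δ^α M) with |α| ≤ N generate over F⟨x⟩ a field containing m·B(N)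
independent derivatives of z. If d invariants y are δ-independent, their d·B(N) derivatives are
fixed by φ. Together with a transcendence basis chosen among the φ(δ^α M) they are φ-images of
independent functions of order at most N + c, so (d + m)·B(N) ≤ n·B(N+c).

Lower bound (`exists_diffAlgIndep_invField`). Choose finitely many rows δ^β x that form a basis of
the span of all rows δ^α x. Substitutions multiply every row by the same constant matrix h, so the
coefficients of the other rows in this basis are invariant (`coeff_mem_invField`). Finitely many
such coefficients a, the basis rows and the entries of M generate all jets. The derivatives of a
grow like s·B(N), where s is the size of a maximal δ-independent subfamily
(`exists_diffAlgIndep_growth`), and those of M contribute at most m·B(N+1) because M is closed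
(`ncard_iter_closed_le`). Hence n ≤ s + m. -/

namespace DiffInv

noncomputable section

universe u

/-! ### Algebraic closure, transcendence counts, and derivations of algebraic elements. -/

section AlgebraicDependence

open AlgebraicIndependent

variable {k L : Type*} [Field k] [Field L] [Algebra k L]

/-- The relative algebraic closure in `L` of the field generated by `X` over `k`. -/
def acl (k : Type*) {L : Type*} [Field k] [Field L] [Algebra k L] (X : Set L) :
    IntermediateField k L :=
  (algebraicClosure (IntermediateField.adjoin k X) L).restrictScalars k

theorem mem_acl {X : Set L} {a : L} :
    a ∈ acl k X ↔ IsAlgebraic (IntermediateField.adjoin k X) a := by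
  rw [acl, IntermediateField.mem_restrictScalars, mem_algebraicClosure_iff]

theorem coe_acl (X : Set L) : (acl k X : Set L) = (matroid k L).closure X := by
  ext a
  rw [matroid_closure_eq, SetLike.mem_coe, mem_acl, IntermediateField.isAlgebraic_adjoin_iff]
  rfl

theorem adjoin_le_acl (X : Set L) : IntermediateField.adjoin k X ≤ acl k X := fun a ha =>
  mem_acl.2 (isAlgebraic_algebraMap (⟨a, ha⟩ : IntermediateField.adjoin k X))

theorem subset_acl (X : Set L) : X ⊆ acl k X := fun _ ha =>
  adjoin_le_acl X (IntermediateField.subset_adjoin k X ha)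

theorem acl_le {X Y : Set L} (h : X ⊆ acl k Y) : acl k X ≤ acl k Y := by
  rw [← SetLike.coe_subset_coe, coe_acl, coe_acl]
  rw [coe_acl] at h
  exact Matroid.closure_subset_closure_of_subset_closure h

theorem acl_mono {X Y : Set L} (h : X ⊆ Y) : acl k X ≤ acl k Y :=
  acl_le (h.trans (subset_acl Y))

/-- In the matroid of algebraic dependence, an independent set inside the closure of X has at most
rank X elements. All transcendence degree comparisons below go through this count. -/
theorem card_le_of_algebraicIndependent {ι : Type*} {a : ι → L} (ha : AlgebraicIndependent k a)
    {X : Set L} (hX : X.Finite) (h : ∀ i, a i ∈ acl k X) : Nat.card ι ≤ X.ncard := by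
  have h1 : (matroid k L).Indep (Set.range a) := matroid_indep_iff.2 ha.coe_range
  have h2 : Set.range a ⊆ (matroid k L).closure X := by
    rw [← coe_acl]
    rintro _ ⟨i, rfl⟩
    exact h i
  have h3 := h1.encard_le_eRk_of_subset h2
  rw [Matroid.eRk_closure_eq] at h3
  have h4 := h3.trans (Matroid.eRk_le_encard _ _)
  have h5 : (Set.range a).Finite := Set.encard_lt_top_iff.1 (h4.trans_lt hX.encard_lt_top)
  rw [← h5.cast_ncard_eq, ← hX.cast_ncard_eq, Nat.cast_le] at h4
  rwa [← Nat.card_coe_set_eq, Nat.card_range_of_injective ha.injective] at h4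

/-- A finite family that algebraically generates at least as many independent elements as it has
members is algebraically independent. -/
theorem algebraicIndependent_of_card_le {ι κ : Type*} [Finite ι] {a : ι → L} {b : κ → L}
    (hb : AlgebraicIndependent k b) (h : ∀ j, b j ∈ acl k (Set.range a))
    (hc : Nat.card ι ≤ Nat.card κ) : AlgebraicIndependent k a := by
  classical
  cases nonempty_fintype ι
  refine algebraicIndependent_of_finite_type' (algebraMap k L).injective fun t _ _ i hi halg => ?_
  -- If some a_i is algebraic over the others, the b_j are all algebraic over fewer than `Nat.card
  -- ι` elements.
  have h1 : a i ∈ acl k (a '' {i}ᶜ) := by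
    refine acl_mono (X := a '' t) (Set.image_mono ?_) ?_
    · intro j hj hji
      rw [Set.mem_singleton_iff] at hji
      exact hi (hji ▸ hj)
    · exact mem_acl.2 (IntermediateField.isAlgebraic_adjoin_iff.2 halg)
  have h2 : acl k (Set.range a) ≤ acl k (a '' {i}ᶜ) := by
    refine acl_le ?_
    rintro _ ⟨j, rfl⟩
    by_cases hj : j = i
    · exact hj ▸ h1
    · exact subset_acl _ ⟨j, hj, rfl⟩
  have h3 := card_le_of_algebraicIndependent hb (Set.toFinite _) fun j => h2 (h j)
  have h4 : (a '' {i}ᶜ).ncard ≤ ({i}ᶜ : Set ι).ncard := Set.ncard_image_le (Set.toFinite _)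
  have h5 : ({i}ᶜ : Set ι).ncard < Nat.card ι := by
    rw [← Set.ncard_univ]
    exact Set.ncard_lt_ncard (Set.ssubset_univ_iff.2 (by simp)) (Set.toFinite _)
  omega

/-- Among the members of a dependent family that is minimal with this property, each is algebraic
over the others. -/
theorem exists_finset_minimal_dependent {ι : Type*} [DecidableEq ι] {a : ι → L}
    (ha : ¬ AlgebraicIndependent k a) :
    ∃ T : Finset ι, ¬ AlgebraicIndepOn k a (T : Set ι) ∧
      ∀ i ∈ T, a i ∈ acl k (a '' (T.erase i : Set ι)) := by
  have h1 : ∃ T : Finset ι, ¬ AlgebraicIndepOn k a (T : Set ι) := by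
    by_contra! hcon
    refine ha (algebraicIndependent_of_finite_type' (algebraMap k L).injective
      fun t ht _ i hi => ?_)
    have h := hcon (insert i ht.toFinset)
    rw [Finset.coe_insert, Set.Finite.coe_toFinset] at h
    exact ((AlgebraicIndepOn.insert_iff hi).1 h).2
  obtain ⟨T, hT, hmin⟩ := WellFounded.has_min (r := fun s t : Finset ι => s < t)
    wellFounded_lt {T : Finset ι | ¬ AlgebraicIndepOn k a (T : Set ι)} h1
  refine ⟨T, hT, fun i hi => ?_⟩
  have h2 : AlgebraicIndepOn k a (T.erase i : Set ι) := by
    by_contra hcon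
    exact hmin _ hcon (Finset.erase_ssubset hi)
  by_contra hcon
  refine hT ?_
  have h3 : (T : Set ι) = insert i (T.erase i : Set ι) := by
    rw [← Finset.coe_insert, Finset.insert_erase hi]
  rw [h3, AlgebraicIndepOn.insert_iff (by simp)]
  refine ⟨h2, fun halg => hcon ?_⟩
  exact mem_acl.2 (IntermediateField.isAlgebraic_adjoin_iff.2 halg)

theorem deriv_mem_of_mem_adjoin (δ : Der L) {X : Set L} {E : IntermediateField k L}
    (hk : ∀ c : k, δ (algebraMap k L c) ∈ E) (hX : X ⊆ E) (hδ : ∀ a ∈ X, δ a ∈ E) {a : L}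
    (ha : a ∈ IntermediateField.adjoin k X) : δ a ∈ E := by
  have hle : IntermediateField.adjoin k X ≤ E := IntermediateField.adjoin_le_iff.2 hX
  induction ha using IntermediateField.adjoin_induction with
  | mem x hx => exact hδ x hx
  | algebraMap x => exact hk x
  | add x y _ _ h1 h2 => rw [map_add]; exact add_mem h1 h2
  | inv x hx h =>
    rw [Derivation.leibniz_inv, smul_eq_mul]
    exact mul_mem (neg_mem (pow_mem (inv_mem (hle hx)) 2)) h
  | mul x y hx hy h1 h2 =>
    rw [Derivation.leibniz, smul_eq_mul, smul_eq_mul]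
    exact add_mem (mul_mem (hle hx) h2) (mul_mem (hle hy) h1)

/-- The value of a derivation at `p(a)`, for a polynomial `p` over a subfield. -/
theorem deriv_aeval_mem (δ : Der L) {K E : IntermediateField k L}
    (hδ : ∀ c ∈ K, δ c ∈ E) {a : L} (ha : a ∈ E) (p : Polynomial K) :
    δ (Polynomial.aeval a p) - Polynomial.aeval a (Polynomial.derivative p) * δ a ∈ E := by
  induction p using Polynomial.induction_on' with
  | add p q hp hq =>
    rw [map_add, map_add, map_add, map_add, add_mul, add_sub_add_comm]
    exact add_mem hp hq
  | monomial n c =>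
    have h1 : δ (Polynomial.aeval a (Polynomial.monomial n c)) -
        Polynomial.aeval a (Polynomial.derivative (Polynomial.monomial n c)) * δ a =
        a ^ n * δ (c : L) := by
      simp only [Polynomial.derivative_monomial, Polynomial.aeval_monomial, Derivation.leibniz,
        Derivation.leibniz_pow, smul_eq_mul, map_mul, map_natCast, nsmul_eq_mul]
      simp only [IntermediateField.algebraMap_apply]
      ring
    rw [h1]
    exact mul_mem (pow_mem ha n) (hδ _ c.2)

/-- Differentiate p(a) = 0 for the minimal polynomial p of a: up to an element of `acl k Y` this
reads p'(a)·δ(a) = 0, and p'(a) ≠ 0 by separability in characteristic zero. -/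
theorem deriv_mem_acl [CharZero L] (δ : Der L) {X Y : Set L}
    (hk : ∀ c : k, δ (algebraMap k L c) ∈ acl k Y) (hX : X ⊆ acl k Y)
    (hδ : ∀ a ∈ X, δ a ∈ acl k Y) {a : L} (ha : a ∈ acl k X) : δ a ∈ acl k Y := by
  have haY : a ∈ acl k Y := acl_le hX ha
  have hint : IsIntegral (IntermediateField.adjoin k X) a :=
    isAlgebraic_iff_isIntegral.1 (mem_acl.1 ha)
  have h1 := deriv_aeval_mem δ
    (fun c hc => deriv_mem_of_mem_adjoin δ hk hX hδ hc) haY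
    (minpoly (IntermediateField.adjoin k X) a)
  rw [minpoly.aeval, map_zero, zero_sub, neg_mem_iff] at h1
  have : CharZero (IntermediateField.adjoin k X) :=
    ((algebraMap (IntermediateField.adjoin k X) L).charZero_iff Subtype.val_injective).2
      inferInstance
  have h2 : Polynomial.aeval a (Polynomial.derivative
      (minpoly (IntermediateField.adjoin k X) a)) ≠ 0 :=
    (minpoly.irreducible hint).separable.aeval_derivative_ne_zero (minpoly.aeval _ _)
  have h3 : Polynomial.aeval a (Polynomial.derivative
      (minpoly (IntermediateField.adjoin k X) a)) ∈ acl k Y := by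
    rw [Polynomial.aeval_eq_sum_range]
    refine sum_mem fun i _ => ?_
    rw [Algebra.smul_def]
    exact mul_mem ((IntermediateField.adjoin_le_iff.2 hX) (SetLike.coe_mem _)) (pow_mem haY i)
  have h4 := mul_mem (inv_mem h3) h1
  rwa [inv_mul_cancel_left₀ h2] at h4

end AlgebraicDependence

/-! ### Multi-indices of bounded degree and the growth of their number. -/

section MultiIndex

variable {m : ℕ}

/-- The multi-indices of degree at most `N`. -/
def multi (m N : ℕ) : Finset (Fin m → ℕ) :=
  (Fintype.piFinset fun _ => Finset.range (N + 1)).filter fun α => ∑ i, α i ≤ N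

theorem mem_multi {N : ℕ} {α : Fin m → ℕ} : α ∈ multi m N ↔ ∑ i, α i ≤ N := by
  rw [multi, Finset.mem_filter, Fintype.mem_piFinset]
  refine ⟨fun h => h.2, fun h => ⟨fun i => ?_, h⟩⟩
  rw [Finset.mem_range]
  have := Finset.single_le_sum (f := α) (fun _ _ => Nat.zero_le _) (Finset.mem_univ i)
  omega

theorem multi_mono {N N' : ℕ} (h : N ≤ N') : multi m N ⊆ multi m N' := fun _ hα =>
  mem_multi.2 ((mem_multi.1 hα).trans h)

theorem sum_add_single (α : Fin m → ℕ) (k : Fin m) :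
    ∑ i, (α + Pi.single k 1 : Fin m → ℕ) i = ∑ i, α i + 1 := by
  simp [Finset.sum_add_distrib]

theorem add_single_mem_multi {N : ℕ} {α : Fin m → ℕ} (h : α ∈ multi m N) (k : Fin m) :
    α + Pi.single k 1 ∈ multi m (N + 1) := by
  rw [mem_multi, sum_add_single]
  exact Nat.succ_le_succ (mem_multi.1 h)

theorem exists_eq_add_single {α : Fin m → ℕ} (h : α ≠ 0) :
    ∃ (k : Fin m) (β : Fin m → ℕ), α = β + Pi.single k 1 := by
  obtain ⟨k, hk⟩ := Function.ne_iff.1 h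
  refine ⟨k, α - Pi.single k 1, ?_⟩
  ext i
  by_cases hi : i = k
  · subst hi
    have : α i ≠ 0 := hk
    simp
    omega
  · simp [hi]

theorem multi_induction {p : (Fin m → ℕ) → Prop} (zero : p 0)
    (add_single : ∀ α k, p α → p (α + Pi.single k 1)) (α : Fin m → ℕ) : p α := by
  induction hN : ∑ i, α i generalizing α with
  | zero =>
    have : α = 0 := by
      ext i
      exact (Finset.sum_eq_zero_iff.1 hN) i (Finset.mem_univ i)
    exact this ▸ zero
  | succ N ih =>
    have h0 : α ≠ 0 := by
      rintro rfl
      simp at hN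
    obtain ⟨k, β, rfl⟩ := exists_eq_add_single h0
    rw [sum_add_single] at hN
    exact add_single _ _ (ih β (by omega))

/-- A slack coordinate N - |α| turns degree at most N in m entries into degree exactly N in m + 1
entries. -/
theorem card_multi (m N : ℕ) : (multi m N).card = (N + m).choose m := by
  have e : multi m N ≃ {P : Fin (m + 1) → ℕ // ∑ i, P i = N} :=
    { toFun := fun α => ⟨Fin.cons (N - ∑ i, α.1 i) α.1, by
        have := mem_multi.1 α.2
        rw [Fin.sum_univ_succ]
        simp only [Fin.cons_zero, Fin.cons_succ]
        omega⟩
      invFun := fun P => ⟨Fin.tail P.1, by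
        rw [mem_multi]
        have := P.2
        rw [Fin.sum_univ_succ] at this
        simp only [Fin.tail]
        omega⟩
      left_inv := fun α => by simp
      right_inv := fun P => by
        ext i
        have := P.2
        rw [Fin.sum_univ_succ] at this
        refine Fin.cases ?_ (fun j => ?_) i
        · simp only [Fin.cons_zero, Fin.tail]
          omega
        · simp [Fin.tail] }
  have h := Fintype.card_congr (e.trans (Sym.equivNatSumOfFintype (Fin (m + 1)) N).symm)
  rw [Fintype.card_coe, Sym.card_sym_eq_choose, Fintype.card_fin] at h
  rw [h, show m + 1 + N - 1 = N + m by omega, ← Nat.choose_symm_add]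

open scoped Classical in
-- Translation by α embeds the indices of degree at most N into the multiples of α of degree at most
-- N + c. What remains, B(N+c) - B(N), is of lower order; it is stated as a sum to avoid truncated
-- subtraction.
theorem card_filter_not_le {α : Fin m → ℕ} {c : ℕ} (hα : ∑ i, α i ≤ c) (N : ℕ) :
    ((multi m (N + c)).filter fun γ => ¬ α ≤ γ).card + (multi m N).card ≤
      (multi m (N + c)).card := by
  rw [← Finset.card_filter_add_card_filter_not (s := multi m (N + c)) (fun γ => α ≤ γ), add_comm]
  refine Nat.add_le_add_right ?_ _
  refine Finset.card_le_card_of_injOn (fun β => α + β) (fun β hβ => ?_)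
    (fun β _ γ _ h => add_left_cancel h)
  have := mem_multi.1 hβ
  simp only [Finset.coe_filter, Set.mem_ofPred_eq, mem_multi, Pi.add_apply,
    Finset.sum_add_distrib]
  exact ⟨by omega, le_self_add⟩

open Filter Topology in
-- For c = 1 the quotient is 1 + m/(N+1); the general case multiplies c such quotients.
theorem tendsto_card_multi_div (m c : ℕ) :
    Tendsto (fun N => ((multi m (N + c)).card : ℝ) / (multi m N).card) atTop (𝓝 1) := by
  have hpos : ∀ N, ((multi m N).card : ℝ) ≠ 0 := fun N => by
    rw [card_multi]
    exact_mod_cast (Nat.choose_pos (Nat.le_add_left m N)).ne'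
  have h1 : Tendsto (fun N => ((multi m (N + 1)).card : ℝ) / (multi m N).card) atTop (𝓝 1) := by
    have h2 : ∀ N : ℕ, ((multi m (N + 1)).card : ℝ) / (multi m N).card =
        1 + m * (1 / ((N : ℝ) + 1)) := fun N => by
      have h3 := Nat.choose_mul_succ_eq (N + m) m
      rw [show N + m + 1 - m = N + 1 by omega] at h3
      have h4 : ((multi m N).card : ℝ) * (N + m + 1) = (multi m (N + 1)).card * (N + 1) := by
        rw [card_multi, card_multi, show N + 1 + m = N + m + 1 by omega]
        exact_mod_cast h3
      rw [div_eq_iff (hpos N)]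
      have : (N : ℝ) + 1 ≠ 0 := by positivity
      field_simp
      linarith
    simp_rw [h2]
    have := (tendsto_one_div_add_atTop_nhds_zero_nat (𝕜 := ℝ)).const_mul (m : ℝ) |>.const_add 1
    simpa using this
  induction c with
  | zero => simp [div_self (hpos _)]
  | succ c ih =>
    have h2 := (h1.comp (tendsto_add_atTop_nat c)).mul ih
    rw [one_mul] at h2
    refine h2.congr fun N => ?_
    simp only [Function.comp]
    rw [← add_assoc, div_mul_div_cancel₀ (hpos _)]

open Filter Topology in
/-- Comparison of the leading coefficients of two growth functions. -/
theorem le_of_forall_card_multi_le (hm : 0 < m) {d s q c K : ℕ}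
    (h : ∀ N, d * (multi m N).card + q * (multi m N).card ≤
      s * (multi m (N + c)).card + q * (multi m (N + c)).card + K) : d ≤ s := by
  have hpos : ∀ N, (0 : ℝ) < (multi m N).card := fun N => by
    rw [card_multi]
    exact_mod_cast (Nat.choose_pos (Nat.le_add_left m N))
  have hinf : Tendsto (fun N => ((multi m N).card : ℝ)) atTop atTop := by
    refine tendsto_atTop_mono (fun N => ?_) tendsto_natCast_atTop_atTop
    have : N ≤ (multi m N).card := by
      have h1 : N + 1 = (multi 1 N).card := by rw [card_multi, Nat.choose_one_right]
      rw [card_multi, ← Nat.choose_symm_add]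
      have h2 : (N + 1).choose N ≤ (N + m).choose N := Nat.choose_le_choose N (by omega)
      rw [Nat.choose_succ_self_right] at h2
      omega
    exact_mod_cast this
  -- Divide by B(N) and let N tend to infinity; since m > 0, B(N) is unbounded and K disappears. The
  -- common summand q absorbs errors of the form q·(B(N+c) - B(N)).
  have h1 := (((tendsto_card_multi_div m c).const_mul ((s : ℝ) + q))).add
    (tendsto_const_nhds (x := (K : ℝ)).div_atTop hinf)
  rw [mul_one, add_zero] at h1
  have h2 : (d : ℝ) + q ≤ s + q := by
    refine ge_of_tendsto' h1 fun N => ?_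
    have h3 : ((d : ℝ) + q) * (multi m N).card ≤ (s + q) * (multi m (N + c)).card + K := by
      have := h N
      rw [← add_mul, ← add_mul] at this
      exact_mod_cast this
    rw [mul_div_assoc', ← add_div, le_div_iff₀ (hpos N)]
    exact h3
  exact_mod_cast (add_le_add_iff_right _).1 h2

end MultiIndex

/-! ### Iterates of commuting derivations. -/

section Iterates

variable {L : Type*} [Field L] {m : ℕ}

theorem list_prod_map_pow_add {G ι : Type*} [Monoid G] {f : ι → G}
    (hf : ∀ i j, Commute (f i) (f j)) (a b : ι → ℕ) (l : List ι) :
    (l.map fun i => f i ^ (a + b) i).prod =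
      (l.map fun i => f i ^ a i).prod * (l.map fun i => f i ^ b i).prod := by
  induction l with
  | nil => simp
  | cons i l ih =>
    have h : Commute (f i ^ b i) (l.map fun i => f i ^ a i).prod := by
      refine Commute.list_prod_right _ _ fun x hx => ?_
      obtain ⟨j, -, rfl⟩ := List.mem_map.1 hx
      exact (hf i j).pow_pow _ _
    rw [List.map_cons, List.prod_cons, ih, Pi.add_apply, pow_add, List.map_cons, List.prod_cons,
      List.map_cons, List.prod_cons, mul_assoc, mul_assoc, ← mul_assoc (f i ^ b i), h.eq, mul_assoc]

theorem list_prod_map_pow_single {G ι : Type*} [Monoid G] [DecidableEq ι] (f : ι → G) (k : ι)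
    {l : List ι} (hl : l.Nodup) :
    (l.map fun i => f i ^ (Pi.single k 1 : ι → ℕ) i).prod = if k ∈ l then f k else 1 := by
  induction l with
  | nil => simp
  | cons i l ih =>
    rw [List.nodup_cons] at hl
    rw [List.map_cons, List.prod_cons, ih hl.2]
    by_cases hi : k = i
    · subst hi
      simp [hl.1]
    · simp [hi, Ne.symm hi]

theorem iter_zero (δ : Fin m → Der L) (a : L) : iter δ 0 a = a := by
  simp [iter]

/-- The product in `iter` has a fixed order of factors; commutation lets one more δ_k be moved to
the front. -/
theorem iter_add_single {δ : Fin m → Der L} (hδ : ∀ i j a, δ i (δ j a) = δ j (δ i a))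
    (α : Fin m → ℕ) (k : Fin m) (a : L) :
    iter δ (α + Pi.single k 1) a = δ k (iter δ α a) := by
  have hc : ∀ i j, Commute ((δ i : L →ₗ[ℤ] L) : Module.End ℤ L) (δ j : L →ₗ[ℤ] L) :=
    fun i j => LinearMap.ext fun a => hδ i j a
  rw [add_comm]
  simp only [iter]
  rw [list_prod_map_pow_add hc, list_prod_map_pow_single _ _ (List.nodup_finRange m)]
  simp

/-- A map that intertwines two systems of derivations intertwines their iterates. -/
theorem map_iter {L' : Type*} [Field L'] (φ : L → L') {δ : Fin m → Der L} {δ' : Fin m → Der L'}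
    (h : ∀ k a, φ (δ k a) = δ' k (φ a)) (α : Fin m → ℕ) (a : L) :
    φ (iter δ α a) = iter δ' α (φ a) := by
  have hpow : ∀ k n a, φ ((((δ k : L →ₗ[ℤ] L) : Module.End ℤ L) ^ n) a) =
      (((δ' k : L' →ₗ[ℤ] L') : Module.End ℤ L') ^ n) (φ a) := fun k n a => by
    induction n generalizing a with
    | zero => simp
    | succ n ih =>
      rw [pow_succ, pow_succ, Module.End.mul_apply, Module.End.mul_apply, ih]
      exact congrArg _ (h k a)
  simp only [iter]
  generalize List.finRange m = l
  induction l generalizing a with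
  | nil => simp
  | cons k l ih =>
    simp only [List.map_cons, List.prod_cons, Module.End.mul_apply]
    rw [hpow, ih]

/-- The threshold c leaves room for derivations whose coefficients themselves lie only in level c.
-/
theorem iter_mem_of_filtration {δ : Fin m → Der L} (hδ : ∀ i j a, δ i (δ j a) = δ j (δ i a))
    {S : ℕ → Set L} {c : ℕ} (hS : ∀ N, c ≤ N → ∀ k, ∀ a ∈ S N, δ k a ∈ S (N + 1)) {a : L}
    (ha : a ∈ S c) (α : Fin m → ℕ) : iter δ α a ∈ S (c + ∑ i, α i) := by
  induction α using multi_induction with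
  | zero => simpa [iter_zero] using ha
  | add_single α k ih =>
    rw [iter_add_single hδ, sum_add_single]
    exact hS _ (Nat.le_add_right _ _) k _ ih

end Iterates

/-! ### Change of frame for systems of derivations. -/

section Gauge

variable {L : Type*} [Field L] {m : ℕ}

theorem gauge_apply (A : Matrix (Fin m) (Fin m) L) (D : Fin m → Der L) (i : Fin m) (a : L) :
    gauge A D i a = ∑ j, A i j * D j a := by
  rw [gauge, ← Derivation.coeFnAddMonoidHom_apply, map_sum, Finset.sum_apply]
  rfl

theorem gauge_gauge (A B : Matrix (Fin m) (Fin m) L) (D : Fin m → Der L) :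
    gauge A (gauge B D) = gauge (A * B) D := by
  ext i a
  simp only [gauge_apply, Matrix.mul_apply, Finset.mul_sum, Finset.sum_mul, mul_assoc]
  exact Finset.sum_comm

theorem gauge_one (D : Fin m → Der L) : gauge 1 D = D := by
  ext i a
  simp [gauge_apply, Matrix.one_apply]

theorem gauge_inv_cancel {A : Matrix (Fin m) (Fin m) L} (hA : A.det ≠ 0) (D : Fin m → Der L) :
    gauge A (gauge A⁻¹ D) = D := by
  rw [gauge_gauge, Matrix.mul_nonsing_inv _ (isUnit_iff_ne_zero.2 hA), gauge_one]

/-- If the columns of `A` are closed, then `A⁻¹∂` is again a system of commuting derivations. -/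
theorem gauge_inv_comm {A : Matrix (Fin m) (Fin m) L} (hA : A.det ≠ 0) {D : Fin m → Der L}
    (hD : ∀ i j a, D i (D j a) = D j (D i a)) (hcl : ∀ i j k, D i (A j k) = D j (A i k))
    (i j : Fin m) (a : L) :
    gauge A⁻¹ D i (gauge A⁻¹ D j a) = gauge A⁻¹ D j (gauge A⁻¹ D i a) := by
  set δ := gauge A⁻¹ D with hδ
  have hDδ : ∀ i b, D i b = ∑ k, A i k * δ k b := fun i b => by
    rw [← gauge_apply, hδ, gauge_inv_cancel hA]
  set X : Matrix (Fin m) (Fin m) L := Matrix.of fun k l => δ k (δ l a) with hX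
  -- Expanding in δ gives ∂_i∂_j a = ∑ (∂_i A_jk) δ_k a + (A X Aᵗ)_ij. The left side and the first
  -- sum are symmetric in i and j, hence so is A X Aᵗ, and A cancels.
  have key : A * X * A.transpose = A * X.transpose * A.transpose := by
    ext i j
    have h1 : ∀ i j, D i (D j a) = ∑ k, D i (A j k) * δ k a + (A * X * A.transpose) i j := by
      intro i j
      rw [hDδ j a, map_sum]
      simp only [Derivation.leibniz, smul_eq_mul, Finset.sum_add_distrib]
      rw [add_comm]
      congr 1
      · exact Finset.sum_congr rfl fun k _ => mul_comm _ _
      · simp only [Matrix.mul_apply, Matrix.transpose_apply, hX, Matrix.of_apply]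
        refine Finset.sum_congr rfl fun k _ => ?_
        rw [hDδ i, mul_comm]
    have h2 := hD i j a
    rw [h1, h1] at h2
    simp only [hcl i j] at h2
    have h3 := add_left_cancel h2
    rw [h3]
    have h4 : A * X.transpose * A.transpose = (A * X * A.transpose).transpose := by
      simp [Matrix.transpose_mul, Matrix.mul_assoc]
    rw [h4, Matrix.transpose_apply]
  have hu : IsUnit A.det := isUnit_iff_ne_zero.2 hA
  have hu' : IsUnit A.transpose.det := by rwa [Matrix.det_transpose]
  have h5 : X = X.transpose := by
    have h6 := congrArg (fun Z => A⁻¹ * (Z * A.transpose⁻¹)) key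
    simpa only [Matrix.mul_assoc, Matrix.mul_nonsing_inv _ hu', Matrix.mul_one,
      Matrix.nonsing_inv_mul_cancel_left _ _ hu] using h6
  exact congrFun (congrFun h5 i) j

end Gauge

/-! ### Leaders and the growth of finitely generated differential fields. -/

section Leader

variable {k L : Type*} [Field k] [Field L] [Algebra k L] {m : ℕ}

/-- The degree-lexicographic rank of a multi-index. -/
def degLexKey (α : Fin m → ℕ) : ℕ ×ₗ Lex (Fin m → ℕ) := toLex (∑ i, α i, toLex α)

theorem degLexKey_add (α β : Fin m → ℕ) : degLexKey (α + β) = degLexKey α + degLexKey β := by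
  simp only [degLexKey, Pi.add_apply, Finset.sum_add_distrib]
  rfl

theorem degLexKey_injective : Function.Injective (degLexKey (m := m)) := fun α β h => by
  have h1 := congrArg (fun z => ofLex (ofLex z).2) h
  exact h1

theorem sum_le_of_degLexKey_le {α β : Fin m → ℕ} (h : degLexKey α ≤ degLexKey β) :
    ∑ i, α i ≤ ∑ i, β i := by
  rcases Prod.Lex.le_iff.1 h with h | h
  · exact le_of_lt h
  · exact h.1.le

theorem degLexKey_lt_add_single (α : Fin m → ℕ) (l : Fin m) :
    degLexKey α < degLexKey (α + Pi.single l 1) := by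
  refine Prod.Lex.lt_iff.2 (Or.inl ?_)
  change ∑ i, α i < ∑ i, (α + Pi.single l 1 : Fin m → ℕ) i
  rw [sum_add_single]
  exact Nat.lt_succ_self _

theorem diffAlgIndep_subtype_iff {δ : Fin m → Der L} {ι : Type*} {a : ι → L} {S : Set ι} :
    DiffAlgIndep k δ (fun i : S => a i) ↔
      AlgebraicIndepOn k (fun p : ι × (Fin m → ℕ) => iter δ p.2 (a p.1)) {p | p.1 ∈ S} := by
  constructor
  · intro h
    exact h.comp (fun p : {p : ι × (Fin m → ℕ) | p.1 ∈ S} => ((⟨p.1.1, p.2⟩ : S), p.1.2))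
      fun p q hpq => by
        simp only [Prod.mk.injEq, Subtype.mk.injEq] at hpq
        exact Subtype.ext (Prod.ext hpq.1 hpq.2)
  · intro h
    exact AlgebraicIndependent.comp h
      (fun p : S × (Fin m → ℕ) => (⟨(p.1.1, p.2), p.1.2⟩ : {p : ι × (Fin m → ℕ) | p.1 ∈ S}))
      fun p q hpq => by
        simp only [Prod.mk.injEq, Subtype.mk.injEq] at hpq
        exact Prod.ext (Subtype.ext hpq.1) hpq.2

/-- The elements on which `δ^α a_j` may depend algebraically, when `a_j` is `δ`-algebraic over the
`a_i` with `i ∈ S`. -/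
def lowerSet (δ : Fin m → Der L) {ι : Type*} (a : ι → L) (S : Set ι) (j : ι) (α : Fin m → ℕ)
    (N : ℕ) : Set L :=
  {z | ∃ γ, degLexKey γ < degLexKey α ∧ z = iter δ γ (a j)} ∪
    {z | ∃ i ∈ S, ∃ γ ∈ multi m N, z = iter δ γ (a i)}

variable {δ : Fin m → Der L} {ι : Type*} {a : ι → L} {S : Set ι}

/-- A minimal dependent set of derivatives must involve a_j, as the rest is independent. Its
derivative of a_j of highest rank is algebraic over the other members. -/
theorem exists_leader {j : ι} (hS : DiffAlgIndep k δ (fun i : S => a i))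
    (hj : ¬ DiffAlgIndep k δ (fun i : (insert j S : Set ι) => a i)) :
    ∃ α c, iter δ α (a j) ∈ acl k (lowerSet δ a S j α c) := by
  classical
  rw [diffAlgIndep_subtype_iff] at hS hj
  obtain ⟨T, hT, hTalg⟩ := exists_finset_minimal_dependent hj
  have hne : (T.filter fun p => p.1.1 = j).Nonempty := by
    rw [Finset.nonempty_iff_ne_empty]
    intro hemp
    refine hT ?_
    have hmem : ∀ p ∈ T, p.1.1 ∈ S := fun p hp => by
      rcases p.2 with h | h
      · have : p ∈ T.filter fun p => p.1.1 = j := Finset.mem_filter.2 ⟨hp, h⟩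
        rw [hemp] at this
        simp at this
      · exact h
    exact AlgebraicIndependent.comp hS
      (fun p : (T : Set {p : ι × (Fin m → ℕ) | p.1 ∈ insert j S}) =>
        (⟨p.1.1, hmem p.1 p.2⟩ : {p : ι × (Fin m → ℕ) | p.1 ∈ S}))
      fun p q hpq => by
        simp only [Subtype.mk.injEq] at hpq
        exact Subtype.ext (Subtype.ext hpq)
  obtain ⟨p, hp, hmax⟩ := Finset.exists_max_image _ (fun p => degLexKey p.1.2) hne
  rw [Finset.mem_filter] at hp
  refine ⟨p.1.2, T.sup fun q => ∑ i, q.1.2 i, ?_⟩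
  have h1 := hTalg p hp.1
  simp only [hp.2] at h1
  refine acl_mono ?_ h1
  rintro _ ⟨q, hq, rfl⟩
  rw [Finset.mem_coe, Finset.mem_erase] at hq
  by_cases hqj : q.1.1 = j
  · left
    refine ⟨q.1.2, lt_of_le_of_ne (hmax q (Finset.mem_filter.2 ⟨hq.2, hqj⟩)) fun h => hq.1 ?_, by
      simp only [hqj]⟩
    exact Subtype.ext (Prod.ext (hqj.trans hp.2.symm) (degLexKey_injective h))
  · right
    exact ⟨q.1.1, q.2.resolve_left hqj, q.1.2,
      mem_multi.2 (Finset.le_sup (f := fun q : {p : ι × (Fin m → ℕ) | p.1 ∈ insert j S} =>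
        ∑ i, q.1.2 i) hq.2), rfl⟩

/-- The algebraic relation can be differentiated by `deriv_mem_acl`. The rank is additive, so
δ^(α+β) a_j remains strictly above every other derivative of a_j involved. -/
theorem iter_leader_mem_acl [CharZero L] (hδ : ∀ i j a, δ i (δ j a) = δ j (δ i a))
    (hk : ∀ i (c : k), δ i (algebraMap k L c) = 0) {j : ι} {α : Fin m → ℕ} {c : ℕ}
    (h : iter δ α (a j) ∈ acl k (lowerSet δ a S j α c)) (β : Fin m → ℕ) :
    iter δ (α + β) (a j) ∈ acl k (lowerSet δ a S j (α + β) (c + ∑ i, β i)) := by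
  induction β using multi_induction with
  | zero => simpa using h
  | add_single β l ih =>
    rw [← add_assoc, sum_add_single, ← add_assoc, iter_add_single hδ]
    refine deriv_mem_acl (δ l) (fun c => by rw [hk]; exact zero_mem _) (fun z hz => ?_)
      (fun z hz => ?_) ih
    · refine subset_acl _ ?_
      rcases hz with ⟨γ, hγ, rfl⟩ | ⟨i, hi, γ, hγ, rfl⟩
      · exact Or.inl ⟨γ, hγ.trans (degLexKey_lt_add_single _ l), rfl⟩
      · exact Or.inr ⟨i, hi, γ, multi_mono (Nat.le_succ _) hγ, rfl⟩
    · refine subset_acl _ ?_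
      rcases hz with ⟨γ, hγ, rfl⟩ | ⟨i, hi, γ, hγ, rfl⟩
      · refine Or.inl ⟨γ + Pi.single l 1, ?_, (iter_add_single hδ _ _ _).symm⟩
        rw [degLexKey_add, degLexKey_add _ (Pi.single l 1)]
        exact add_lt_add_left hγ _
      · exact Or.inr ⟨i, hi, γ + Pi.single l 1, add_single_mem_multi hγ l,
          (iter_add_single hδ _ _ _).symm⟩

/-- A finite family contains a `δ`-independent subfamily that bounds its growth. -/
theorem exists_diffAlgIndep_growth [CharZero L] (hδ : ∀ i j a, δ i (δ j a) = δ j (δ i a))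
    (hk : ∀ i (c : k), δ i (algebraMap k L c) = 0) [Fintype ι] (a : ι → L) :
    ∃ (S : Finset ι) (c : ℕ), DiffAlgIndep k δ (fun i : S => a i) ∧
      ∀ N, ∃ X : Set L, X.Finite ∧
        X.ncard + Fintype.card ι * (multi m N).card ≤
          S.card * (multi m (N + 2 * c)).card + Fintype.card ι * (multi m (N + c)).card ∧
        ∀ i, ∀ α ∈ multi m (N + c), iter δ α (a i) ∈ acl k X := by
  classical
  have hempty : DiffAlgIndep k δ (fun i : ((∅ : Finset ι) : Set ι) => a i) := by
    have : IsEmpty (((∅ : Finset ι) : Set ι) × (Fin m → ℕ)) := by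
      simp only [Finset.coe_empty]
      infer_instance
    exact algebraicIndependent_empty_type_iff.2 (algebraMap k L).injective
  obtain ⟨S, hS, hmax⟩ := WellFounded.has_min (r := fun s t : Finset ι => t < s)
    wellFounded_gt {S : Finset ι | DiffAlgIndep k δ (fun i : (S : Set ι) => a i)} ⟨∅, hempty⟩
  have hlead : ∀ j, ∃ α c, iter δ α (a j) ∈ acl k (lowerSet δ a S j α c) := fun j => by
    by_cases hj : j ∈ S
    -- For j in S the leader 0 is admissible, since a_j itself belongs to the second half of
    -- `lowerSet`.
    · refine ⟨0, 0, subset_acl _ (Or.inr ⟨j, hj, 0, ?_, rfl⟩)⟩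
      simp [mem_multi]
    · refine exists_leader hS fun hcon => hmax (insert j S) ?_ (Finset.ssubset_insert hj)
      change DiffAlgIndep k δ (fun i : ((insert j S : Finset ι) : Set ι) => a i)
      rw [Finset.coe_insert]
      exact hcon
  choose α c hαc using hlead
  set c₀ := Finset.univ.sup (fun j => c j + ∑ i, α j i) with hc₀
  have hle : ∀ j, c j + ∑ i, α j i ≤ c₀ := fun j =>
    Finset.le_sup (f := fun j => c j + ∑ i, α j i) (Finset.mem_univ j)
  refine ⟨S, c₀, hS, fun N => ?_⟩
  -- X₁ holds the derivatives of the independent members, X₂ the derivatives that are not multiples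
  -- of a leader. A leader of a_j is raised by at most N + c₀, which brings in derivatives from S of
  -- order up to N + 2c₀.
  set X₁ : Finset L := (S ×ˢ multi m (N + 2 * c₀)).image fun p => iter δ p.2 (a p.1) with hX₁
  set X₂ : Finset L := Finset.univ.biUnion fun j =>
    ((multi m (N + c₀)).filter fun γ => ¬ α j ≤ γ).image fun γ => iter δ γ (a j) with hX₂
  refine ⟨(X₁ ∪ X₂ : Finset L), Finset.finite_toSet _, ?_, fun j β hβ => ?_⟩
  · rw [Set.ncard_coe_finset]
    have h1 : X₁.card ≤ S.card * (multi m (N + 2 * c₀)).card :=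
      Finset.card_image_le.trans (Finset.card_product _ _).le
    have h2 : X₂.card + Fintype.card ι * (multi m N).card ≤
        Fintype.card ι * (multi m (N + c₀)).card := by
      have h3 : X₂.card ≤ ∑ j, ((multi m (N + c₀)).filter fun γ => ¬ α j ≤ γ).card :=
        Finset.card_biUnion_le.trans (Finset.sum_le_sum fun j _ => Finset.card_image_le)
      have h4 : ∑ j : ι, (((multi m (N + c₀)).filter fun γ => ¬ α j ≤ γ).card +
          (multi m N).card) ≤ ∑ _j : ι, (multi m (N + c₀)).card :=
        Finset.sum_le_sum fun j _ => by
          convert card_filter_not_le (α := α j) (c := c₀)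
            ((Nat.le_add_left _ _).trans (hle j)) N using 3
      rw [Finset.sum_add_distrib, Finset.sum_const, Finset.sum_const, Finset.card_univ,
        smul_eq_mul, smul_eq_mul] at h4
      omega
    have h5 := Finset.card_union_le X₁ X₂
    omega
  -- Reduction modulo leaders: a multiple of the leader depends on X₁ and on derivatives of smaller
  -- rank, and any other derivative lies in X₂.
  · induction hβk : degLexKey β using WellFoundedLT.induction generalizing β with
    | ind z ih =>
      subst hβk
      by_cases hle' : α j ≤ β
      · obtain ⟨η, rfl⟩ := exists_add_of_le hle'
        have hdeg := mem_multi.1 hβ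
        simp only [Pi.add_apply, Finset.sum_add_distrib] at hdeg
        refine acl_le ?_ (iter_leader_mem_acl hδ hk (hαc j) η)
        rintro _ (⟨γ, hγ, rfl⟩ | ⟨i, hi, γ, hγ, rfl⟩)
        · exact ih _ hγ γ (mem_multi.2
            ((sum_le_of_degLexKey_le hγ.le).trans (mem_multi.1 hβ))) rfl
        · refine subset_acl _ ?_
          rw [Finset.coe_union]
          refine Or.inl (Finset.mem_coe.2 (Finset.mem_image.2
            ⟨(i, γ), Finset.mem_product.2 ⟨hi, multi_mono ?_ hγ⟩, rfl⟩))
          have := hle j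
          omega
      · refine subset_acl _ ?_
        rw [Finset.coe_union]
        exact Or.inr (Finset.mem_coe.2 (Finset.mem_biUnion.2 ⟨j, Finset.mem_univ j,
          Finset.mem_image.2 ⟨β, Finset.mem_filter.2 ⟨hβ, hle'⟩, rfl⟩⟩))

end Leader

/-! ### Nonzero differential polynomials do not vanish identically on F. -/

section Nonvanishing

/-- A linear form vanishing on all evaluation vectors would be a linear relation between the ψ_i. -/
theorem span_eval_eq_top {E X ι : Type*} [Field E] [Finite ι] {ψ : ι → X → E}
    (hψ : LinearIndependent E ψ) :
    Submodule.span E (Set.range fun x i => ψ i x) = (⊤ : Submodule E (ι → E)) := by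
  classical
  cases nonempty_fintype ι
  by_contra hcon
  obtain ⟨f, hf, hle⟩ := Submodule.exists_le_ker_of_lt_top _ (lt_top_iff_ne_top.2 hcon)
  have h1 : ∀ v : ι → E, f v = ∑ i, v i * f (Pi.single i 1) := fun v => by
    conv_lhs => rw [pi_eq_sum_univ' v, map_sum]
    refine Finset.sum_congr rfl fun i _ => ?_
    rw [← smul_eq_mul, ← map_smul]
  have h2 : ∑ i, f (Pi.single i 1) • ψ i = 0 := by
    ext x
    have h3 : f (fun i => ψ i x) = 0 := hle (Submodule.subset_span ⟨x, rfl⟩)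
    rw [h1] at h3
    simpa [Finset.sum_apply, mul_comm] using h3
  have h4 := Fintype.linearIndependent_iff.1 hψ _ h2
  refine hf (LinearMap.ext fun v => ?_)
  rw [h1 v]
  simp only [h4, mul_zero, Finset.sum_const_zero, LinearMap.zero_apply]

variable {F : Type*} [Field F] {m : ℕ} {D : Fin m → Der F}

/-- Supplies local coordinates: the vectors (D_i x)_i span F^m, so m of them form a basis. -/
theorem exists_det_deriv_ne_zero (hlin : LinearIndependent F D) :
    ∃ t : Fin m → F, (Matrix.of fun i j => D i (t j)).det ≠ 0 := by
  have h1 : LinearIndependent F (fun i => (D i : F → F)) := by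
    rw [Fintype.linearIndependent_iff] at hlin ⊢
    intro c hc
    refine hlin c ?_
    ext a
    have h := congrFun hc a
    rw [← Derivation.coeFnAddMonoidHom_apply, map_sum]
    simpa [Finset.sum_apply] using h
  have h2 := span_eval_eq_top h1
  obtain ⟨f, hf, -, hli⟩ := Submodule.exists_fun_fin_finrank_span_eq F
    (Set.range fun x i => D i x)
  have h3 : Module.finrank F (Submodule.span F (Set.range fun x i => D i x)) = m := by
    rw [h2, finrank_top, Module.finrank_fin_fun]
  choose t ht using hf
  refine ⟨fun j => t (Fin.cast h3.symm j), ?_⟩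
  have h4 : LinearIndependent F
      (Matrix.of fun i j => D i (t (Fin.cast h3.symm j))).transpose.row := by
    have h5 : (Matrix.of fun i j => D i (t (Fin.cast h3.symm j))).transpose.row =
        f ∘ Fin.cast h3.symm := funext fun j => ht (Fin.cast h3.symm j)
    rw [h5]
    exact hli.comp (Fin.cast h3.symm) (Fin.cast_injective _)
  rw [Matrix.linearIndependent_rows_iff_isUnit, Matrix.isUnit_iff_isUnit_det,
    Matrix.det_transpose] at h4
  exact h4.ne_zero

/-- The commutator of δ^β with multiplication by t_i is β_i δ^(β - e_i). When β_i = 0 the truncated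
exponent is harmless, because its coefficient vanishes. -/
theorem iter_coord_mul {δ : Fin m → Der F} (hδ : ∀ i j a, δ i (δ j a) = δ j (δ i a))
    {t : Fin m → F} (ht : ∀ i j, δ i (t j) = if i = j then 1 else 0) (i : Fin m)
    (β : Fin m → ℕ) (f : F) :
    iter δ β (t i * f) = t i * iter δ β f + β i * iter δ (β - Pi.single i 1) f := by
  induction β using multi_induction with
  | zero => simp [iter_zero]
  | add_single β k ih =>
    rw [iter_add_single hδ, ih, map_add, Derivation.leibniz, Derivation.leibniz,
      Derivation.map_natCast, ht, iter_add_single hδ]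
    simp only [smul_eq_mul, mul_zero, add_zero]
    rw [← iter_add_single hδ (β - Pi.single i 1)]
    by_cases hki : k = i
    · subst hki
      rw [add_tsub_cancel_right]
      by_cases h0 : β k = 0
      · simp [h0]
      · have : β - Pi.single k 1 + Pi.single k 1 = β := by
          ext l
          by_cases hl : l = k
          · subst hl
            simp
            omega
          · simp [hl]
        rw [this]
        simp
        ring
    · have : β + Pi.single k 1 - Pi.single i 1 = β - Pi.single i 1 + Pi.single k 1 := by
        ext l
        by_cases hl : l = i
        · subst hl
          simp [Ne.symm hki]
        · simp [hl]
      rw [this]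
      simp [hki, Ne.symm hki]

/-- In coordinates, a differential operator that annihilates `F` is zero. -/
theorem coeff_eq_zero_of_coord [CharZero F] {δ : Fin m → Der F}
    (hδ : ∀ i j a, δ i (δ j a) = δ j (δ i a))
    {t : Fin m → F} (ht : ∀ i j, δ i (t j) = if i = j then 1 else 0) (N : ℕ)
    (c : (Fin m → ℕ) → F) (hc : ∀ f, ∑ β ∈ multi m N, c β * iter δ β f = 0) :
    ∀ β ∈ multi m N, c β = 0 := by
  classical
  induction N generalizing c with
  | zero =>
    have h0 : multi m 0 = {0} := by
      ext α
      rw [mem_multi, Nat.le_zero, Finset.sum_eq_zero_iff, Finset.mem_singleton, funext_iff]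
      simp
    intro β hβ
    rw [h0, Finset.mem_singleton] at hβ
    subst hβ
    have := hc 1
    rw [h0, Finset.sum_singleton, iter_zero, mul_one] at this
    exact this
  | succ N ih =>
    have h1 : ∀ i, ∀ γ ∈ multi m N, c (γ + Pi.single i 1) = 0 := by
      intro i γ hγ
      -- The commutator of the operator with t_i annihilates F too and has order one less; these are
      -- its coefficients. The factor γ_i + 1 is invertible in characteristic zero.
      have h2 : ∀ f, ∑ γ ∈ multi m N, (c (γ + Pi.single i 1) * (γ i + 1 : ℕ)) *
          iter δ γ f = 0 := by
        intro f
        have h3 : ∑ β ∈ multi m (N + 1), c β * β i * iter δ (β - Pi.single i 1) f = 0 := by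
          have h4 := hc (t i * f)
          simp only [iter_coord_mul hδ ht, mul_add, Finset.sum_add_distrib] at h4
          have h5 : ∑ β ∈ multi m (N + 1), c β * (t i * iter δ β f) = 0 := by
            have := congrArg (t i * ·) (hc f)
            simp only [Finset.mul_sum, mul_zero] at this
            rw [← this]
            exact Finset.sum_congr rfl fun β _ => by ring
          rw [h5, zero_add] at h4
          rw [← h4]
          exact Finset.sum_congr rfl fun β _ => by ring
        have h6 : ((multi m N).image fun γ => γ + Pi.single i 1) ⊆ multi m (N + 1) := by
          intro β hβ
          obtain ⟨γ, hγ, rfl⟩ := Finset.mem_image.1 hβ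
          exact add_single_mem_multi hγ i
        rw [← Finset.sum_subset h6] at h3
        · rw [Finset.sum_image fun a _ b _ hab => add_right_cancel hab] at h3
          rw [← h3]
          refine Finset.sum_congr rfl fun γ _ => ?_
          rw [add_tsub_cancel_right]
          simp
        · intro β hβ hβ'
          have h7 : β i = 0 := by
            by_contra hne
            refine hβ' (Finset.mem_image.2 ⟨β - Pi.single i 1, ?_, ?_⟩)
            · have h8 : β = β - Pi.single i 1 + Pi.single i 1 := by
                ext l
                by_cases hl : l = i
                · subst hl
                  simp
                  omega
                · simp [hl]
              have h9 := mem_multi.1 hβ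
              rw [h8, sum_add_single] at h9
              exact mem_multi.2 (Nat.le_of_succ_le_succ h9)
            · ext l
              by_cases hl : l = i
              · subst hl
                simp
                omega
              · simp [hl]
          simp [h7]
      have h10 := ih _ h2 γ hγ
      exact (mul_eq_zero.1 h10).resolve_right (Nat.cast_ne_zero.2 (Nat.succ_ne_zero _))
    have h2 : ∀ β ∈ multi m (N + 1), β ≠ 0 → c β = 0 := by
      intro β hβ h0
      obtain ⟨k, γ, rfl⟩ := exists_eq_add_single h0
      refine h1 k γ (mem_multi.2 ?_)
      have := mem_multi.1 hβ
      rw [sum_add_single] at this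
      omega
    intro β hβ
    by_cases h0 : β = 0
    · subst h0
      have h3 := hc 1
      rw [Finset.sum_eq_single_of_mem 0 hβ fun b hb hb0 => by rw [h2 b hb hb0, zero_mul],
        iter_zero, mul_one] at h3
      exact h3
    · exact h2 β hβ h0

/-- The iterates of `δ = A∂` are linear combinations of the iterates of `∂`. -/
theorem iter_gauge_mem_span (hD : ∀ i j a, D i (D j a) = D j (D i a))
    {A : Matrix (Fin m) (Fin m) F}
    (hδ : ∀ i j a, gauge A D i (gauge A D j a) = gauge A D j (gauge A D i a)) {N : ℕ}
    {β : Fin m → ℕ} (hβ : β ∈ multi m N) :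
    (fun f => iter (gauge A D) β f) ∈
      Submodule.span F (Set.range fun γ : multi m N => fun f => iter D γ.1 f) := by
  set S : ℕ → Submodule F (F → F) := fun N =>
    Submodule.span F (Set.range fun γ : multi m N => fun f => iter D γ.1 f) with hS
  have hmono : ∀ {N N'}, N ≤ N' → S N ≤ S N' := fun {N N'} h => by
    refine Submodule.span_mono ?_
    rintro _ ⟨γ, rfl⟩
    exact ⟨⟨γ.1, multi_mono h γ.2⟩, rfl⟩
  have hstep : ∀ N k, ∀ X ∈ S N, (fun f => gauge A D k (X f)) ∈ S (N + 1) := by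
    intro N k X hX
    induction hX using Submodule.span_induction with
    | mem X hX =>
      obtain ⟨γ, rfl⟩ := hX
      have h1 : (fun f => gauge A D k (iter D γ.1 f)) =
          ∑ l, A k l • fun f => iter D (γ.1 + Pi.single l 1) f := by
        ext f
        simp [gauge_apply, iter_add_single hD]
      change (fun f => gauge A D k (iter D γ.1 f)) ∈ _
      rw [h1]
      exact sum_mem fun l _ => Submodule.smul_mem _ _
        (Submodule.subset_span ⟨⟨_, add_single_mem_multi γ.2 l⟩, rfl⟩)
    | zero =>
      simp only [Pi.zero_apply, map_zero]
      exact zero_mem _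
    | add X Y _ _ hX hY =>
      simp only [Pi.add_apply, map_add]
      exact add_mem hX hY
    | smul c X hX' hX =>
      have h1 : (fun f => gauge A D k ((c • X) f)) =
          c • (fun f => gauge A D k (X f)) + gauge A D k c • X := by
        ext f
        simp [Derivation.leibniz, mul_comm]
      rw [h1]
      exact add_mem (Submodule.smul_mem _ _ hX)
        (Submodule.smul_mem _ _ (hmono (Nat.le_succ N) hX'))
  have key : (fun f => iter (gauge A D) β f) ∈ S (∑ i, β i) := by
    induction β using multi_induction generalizing N with
    | zero =>
      refine Submodule.subset_span ⟨⟨0, by simp [mem_multi]⟩, ?_⟩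
      ext f
      simp [iter_zero]
    | add_single β k ih =>
      rw [sum_add_single]
      simp only [iter_add_single hδ]
      exact hstep _ k _ (ih (N := ∑ i, β i) (mem_multi.2 le_rfl))
  exact hmono (mem_multi.1 hβ) key

/-- The operators `∂^β` are linearly independent over `F`. -/
theorem linearIndependent_iter [CharZero F] (hD : ∀ i j a, D i (D j a) = D j (D i a))
    (hlin : LinearIndependent F D) (N : ℕ) :
    LinearIndependent F fun β : multi m N => fun f => iter D β.1 f := by
  obtain ⟨t, hJ⟩ := exists_det_deriv_ne_zero hlin
  set J : Matrix (Fin m) (Fin m) F := Matrix.of fun i j => D i (t j) with hJdef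
  have hδ := gauge_inv_comm hJ hD fun i j k => hD i j (t k)
  have ht : ∀ i j, gauge J⁻¹ D i (t j) = if i = j then 1 else 0 := fun i j => by
    rw [gauge_apply]
    have h := congrFun (congrFun (Matrix.nonsing_inv_mul J (isUnit_iff_ne_zero.2 hJ)) i) j
    rw [Matrix.mul_apply, Matrix.one_apply] at h
    exact h
  have h1 : LinearIndependent F fun β : multi m N => fun f => iter (gauge J⁻¹ D) β.1 f := by
    rw [Fintype.linearIndependent_iff]
    intro c hc β
    classical
    have h2 := coeff_eq_zero_of_coord hδ ht N
      (fun β => if hβ : β ∈ multi m N then c ⟨β, hβ⟩ else 0) (fun f => by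
        have h3 := congrFun hc f
        rw [← Finset.sum_coe_sort]
        simpa [Finset.sum_apply] using h3) β.1 β.2
    simpa using h2
  -- The B(N) independent iterates in the coordinate frame lie in the span of the B(N) iterates of
  -- D, so the latter are independent as well.
  rw [linearIndependent_iff_card_le_finrank_span, ← finrank_span_eq_card h1]
  have := FiniteDimensional.span_of_finite F
    (Set.finite_range fun β : multi m N => fun f => iter D β.1 f)
  refine Submodule.finrank_mono (Submodule.span_le.2 ?_)
  rintro _ ⟨β, rfl⟩
  exact iter_gauge_mem_span hD hδ β.2

open MvPolynomial in
/-- A nonzero differential polynomial over an extension of `F` does not vanish identically on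
`F`. -/
theorem exists_eval_iter_ne_zero [CharZero F] (hD : ∀ i j a, D i (D j a) = D j (D i a))
    (hlin : LinearIndependent F D) {E κ : Type*} [Field E] [Algebra F E]
    {P : MvPolynomial (κ × (Fin m → ℕ)) E} (hP : P ≠ 0) :
    ∃ z : κ → F, eval (fun p => algebraMap F E (iter D p.2 (z p.1))) P ≠ 0 := by
  classical
  have : CharZero E := charZero_of_injective_algebraMap (algebraMap F E).injective
  set N := P.vars.sup fun p => ∑ i, p.2 i with hN
  have hvars : ∀ p ∈ P.vars, p.2 ∈ multi m N := fun p hp =>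
    mem_multi.2 (Finset.le_sup (f := fun p : κ × (Fin m → ℕ) => ∑ i, p.2 i) hp)
  have hspan := span_eval_eq_top (linearIndependent_iter hD hlin N)
  have hdual : ∀ β : multi m N, ∃ u : F →₀ F, (u.sum fun f c => c • fun γ : multi m N =>
      iter D γ.1 f) = Pi.single β 1 := fun β => by
    rw [← Finsupp.mem_span_range_iff_exists_finsupp, hspan]
    exact Submodule.mem_top
  choose u hu using hdual
  set s : Finset F := Finset.univ.biUnion fun β => (u β).support with hs
  have hu' : ∀ β γ : multi m N, ∑ f ∈ s, u β f * iter D γ.1 f = if β = γ then 1 else 0 := by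
    intro β γ
    have h1 := congrFun (hu β) γ
    rw [Finsupp.sum_of_support_subset (u β) (s := s)
      (Finset.subset_biUnion_of_mem (fun β => (u β).support) (Finset.mem_univ β))
      (fun f c => c • fun γ : multi m N => iter D γ.1 f)
      (fun _ _ => zero_smul _ _), Finset.sum_apply, Pi.single_apply] at h1
    simpa [eq_comm] using h1
  obtain ⟨v, hv⟩ : ∃ v, eval v P ≠ 0 := by
    by_contra! hcon
    exact hP (MvPolynomial.funext fun v => by rw [hcon v, map_zero])
  -- Q is P evaluated at z_j = ∑ c(j,f)·f with undetermined constants c. The dual systems u make any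
  -- values v of the jets reachable over E, so Q ≠ 0.
  set Q : MvPolynomial (κ × F) E := bind₁ (fun p : κ × (Fin m → ℕ) =>
    ∑ f ∈ s, C (algebraMap F E (iter D p.2 f)) * X (p.1, f)) P with hQ
  have hevalQ : ∀ c : κ × F → E, eval c Q =
      eval (fun p => ∑ f ∈ s, algebraMap F E (iter D p.2 f) * c (p.1, f)) P := fun c => by
    rw [hQ, eval, eval₂Hom_bind₁]
    refine eval₂Hom_congr rfl (funext fun p => ?_) rfl
    simp
  have hQ0 : Q ≠ 0 := by
    intro h0
    have h1 := hevalQ fun q => ∑ β : multi m N, v (q.1, β.1) * algebraMap F E (u β q.2)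
    rw [h0, map_zero] at h1
    refine hv ?_
    rw [h1]
    refine eval₂Hom_congr' rfl (fun p hp _ => ?_) rfl
    have h2 := hvars p hp
    simp only [Finset.mul_sum]
    rw [Finset.sum_comm]
    have h3 : ∀ β : multi m N, ∑ f ∈ s, algebraMap F E (iter D p.2 f) *
        (v (p.1, β.1) * algebraMap F E (u β f)) =
        v (p.1, β.1) * if β = ⟨p.2, h2⟩ then 1 else 0 := fun β => by
      have h4 := congrArg (algebraMap F E) (hu' β ⟨p.2, h2⟩)
      rw [map_sum] at h4
      rw [show (if β = ⟨p.2, h2⟩ then (1 : E) else 0) =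
        algebraMap F E (if β = ⟨p.2, h2⟩ then 1 else 0) by split_ifs <;> simp, ← h4,
        Finset.mul_sum]
      refine Finset.sum_congr rfl fun f _ => ?_
      rw [map_mul]
      ring
    simp only [h3]
    simp
  -- Natural numbers suffice for c by characteristic zero, and they commute with the derivations, so
  -- the resulting z lies in F and has the prescribed jets.
  obtain ⟨c, hc, hcQ⟩ : ∃ c ∈ Set.pi Set.univ fun _ : κ × F => Set.range ((↑) : ℕ → E),
      eval c Q ≠ 0 := by
    by_contra! hcon
    exact hQ0 (MvPolynomial.funext_set _
      (fun _ => Set.infinite_range_of_injective Nat.cast_injective) fun x hx => by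
        rw [hcon x hx, map_zero])
  choose c' hc' using fun q : κ × F => hc q (Set.mem_univ q)
  refine ⟨fun j => ∑ f ∈ s, (c' (j, f) : F) * f, ?_⟩
  rw [hevalQ] at hcQ
  convert hcQ using 3
  ext p
  rw [map_sum, map_sum]
  refine Finset.sum_congr rfl fun f _ => ?_
  rw [← nsmul_eq_mul, map_nsmul, map_nsmul, ← hc', nsmul_eq_mul, mul_comm]

end Nonvanishing

/-! ### The order filtration on differential rational functions. -/

section Jets

variable {R : Type*} [Field R] {n m : ℕ}

theorem algebraicIndependent_jet :
    AlgebraicIndependent R fun p : Fin n × (Fin m → ℕ) => jet R p.1 p.2 :=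
  (MvPolynomial.algebraicIndependent_X (Fin n × (Fin m → ℕ)) R).map'
    (f := IsScalarTower.toAlgHom R (DiffPoly R n m) (DiffRat R n m))
    (IsFractionRing.injective (DiffPoly R n m) (DiffRat R n m))

variable (R n m) in
/-- The field generated by the jets of order at most `N`. -/
def jetField (N : ℕ) : IntermediateField R (DiffRat R n m) :=
  IntermediateField.adjoin R
    (Set.range fun p : Fin n × multi m N => jet R p.1 p.2.1)

theorem jet_mem_jetField {N : ℕ} {α : Fin m → ℕ} (hα : α ∈ multi m N) (i : Fin n) :
    jet R i α ∈ jetField R n m N :=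
  IntermediateField.subset_adjoin _ _ ⟨(i, ⟨α, hα⟩), rfl⟩

theorem jetField_mono {N N' : ℕ} (h : N ≤ N') : jetField R n m N ≤ jetField R n m N' := by
  refine IntermediateField.adjoin_le_iff.2 ?_
  rintro _ ⟨⟨i, α⟩, rfl⟩
  exact jet_mem_jetField (multi_mono h α.2) i

theorem exists_mem_jetField (f : DiffRat R n m) : ∃ N, f ∈ jetField R n m N := by
  have hpoly : ∀ p : DiffPoly R n m, ∃ N, algebraMap _ (DiffRat R n m) p ∈ jetField R n m N := by
    intro p
    induction p using MvPolynomial.induction_on with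
    | C a => exact ⟨0, (jetField R n m 0).algebraMap_mem a⟩
    | add p q hp hq =>
      obtain ⟨N, hN⟩ := hp
      obtain ⟨N', hN'⟩ := hq
      refine ⟨max N N', ?_⟩
      rw [map_add]
      exact add_mem (jetField_mono (le_max_left _ _) hN) (jetField_mono (le_max_right _ _) hN')
    | mul_X p i hp =>
      obtain ⟨N, hN⟩ := hp
      refine ⟨max N (∑ l, i.2 l), ?_⟩
      rw [map_mul]
      exact mul_mem (jetField_mono (le_max_left _ _) hN)
        (jet_mem_jetField (mem_multi.2 (le_max_right _ _)) i.1)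
  obtain ⟨p, q, -, rfl⟩ := IsFractionRing.div_surjective (A := DiffPoly R n m) f
  obtain ⟨N, hN⟩ := hpoly p
  obtain ⟨N', hN'⟩ := hpoly q
  exact ⟨max N N', div_mem (jetField_mono (le_max_left _ _) hN)
    (jetField_mono (le_max_right _ _) hN')⟩

theorem exists_forall_mem_jetField {ι : Type*} [Finite ι] (f : ι → DiffRat R n m) :
    ∃ N, ∀ i, f i ∈ jetField R n m N := by
  cases nonempty_fintype ι
  choose N hN using fun i => exists_mem_jetField (f i)
  exact ⟨Finset.univ.sup N, fun i => jetField_mono (Finset.le_sup (Finset.mem_univ i)) (hN i)⟩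

/-- Induction over the field of differential rational functions. -/
theorem diffRat_induction {p : DiffRat R n m → Prop} (algebraMap : ∀ a, p (algebraMap R _ a))
    (jet : ∀ i α, p (jet R i α)) (add : ∀ f g, p f → p g → p (f + g))
    (mul : ∀ f g, p f → p g → p (f * g)) (inv : ∀ f, p f → p f⁻¹) (f : DiffRat R n m) : p f := by
  obtain ⟨N, hN⟩ := exists_mem_jetField f
  induction hN using IntermediateField.adjoin_induction with
  | mem x hx =>
    obtain ⟨q, rfl⟩ := hx
    exact jet _ _
  | algebraMap x => exact algebraMap x
  | add x y _ _ hx hy => exact add x y hx hy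
  | inv x _ hx => exact inv x hx
  | mul x y _ _ hx hy => exact mul x y hx hy

/-- The commutator is a derivation, so it suffices that it vanishes on scalars and on jets. -/
theorem ratDeriv_comm {D : Fin m → Der R} (hD : ∀ i j a, D i (D j a) = D j (D i a))
    (i j : Fin m) (f : DiffRat R n m) :
    ratDeriv D i (ratDeriv D j f) = ratDeriv D j (ratDeriv D i f) := by
  rw [← sub_eq_zero, ← Derivation.commutator_apply]
  induction f using diffRat_induction with
  | algebraMap a =>
    rw [Derivation.commutator_apply]
    simp only [ratDeriv_algebraMap]
    rw [hD, sub_self]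
  | jet l α =>
    rw [Derivation.commutator_apply]
    simp only [ratDeriv_jet]
    rw [add_right_comm, sub_self]
  | add f g hf hg => rw [map_add, hf, hg, add_zero]
  | mul f g hf hg => rw [Derivation.leibniz, hf, hg, smul_zero, smul_zero, add_zero]
  | inv f hf => rw [Derivation.leibniz_inv, hf, smul_zero]

theorem iter_ratDeriv_indet {D : Fin m → Der R} (hD : ∀ i j a, D i (D j a) = D j (D i a))
    (α : Fin m → ℕ) (i : Fin n) : iter (ratDeriv D) α (indet R i) = jet R i α := by
  induction α using multi_induction with
  | zero => rw [iter_zero, indet]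
  | add_single α k ih => rw [iter_add_single (ratDeriv_comm hD), ih, ratDeriv_jet]

theorem ratDeriv_mem_jetField (D : Fin m → Der R) (k : Fin m) {N : ℕ} {f : DiffRat R n m}
    (hf : f ∈ jetField R n m N) : ratDeriv D k f ∈ jetField R n m (N + 1) := by
  refine deriv_mem_of_mem_adjoin (ratDeriv D k) (fun c => ?_) ?_ ?_ hf
  · rw [ratDeriv_algebraMap]
    exact IntermediateField.algebraMap_mem _ _
  · exact (IntermediateField.subset_adjoin _ _).trans (jetField_mono (Nat.le_succ N))
  · rintro _ ⟨⟨i, α⟩, rfl⟩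
    rw [ratDeriv_jet]
    exact jet_mem_jetField (add_single_mem_multi α.2 k) i

/-- An algebraically independent family of functions of order at most `N` has at most as many
members as there are jets of order at most `N`. -/
theorem card_le_of_mem_jetField {ι : Type*} {a : ι → DiffRat R n m}
    (ha : AlgebraicIndependent R a) {N : ℕ} (h : ∀ i, a i ∈ jetField R n m N) :
    Nat.card ι ≤ n * (multi m N).card := by
  refine (card_le_of_algebraicIndependent ha (Set.finite_range _)
    fun i => adjoin_le_acl _ (h i)).trans ?_
  rw [← Nat.card_coe_set_eq]
  refine (Finite.card_range_le _).trans ?_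
  simp

end Jets

/-! ### The substitutions ∂ ↦ g⁻¹∂, x ↦ xh as field homomorphisms. -/

section Substitution

variable {F : Type*} [Field F] {m n : ℕ} {D : Fin m → Der F}

theorem map_inv_eq {L : Type*} [Field L] (f : F →+* L) (g : GL (Fin m) F) :
    ((g⁻¹ : GL (Fin m) F) : Matrix (Fin m) (Fin m) F).map f =
      ((g : Matrix (Fin m) (Fin m) F).map f)⁻¹ := by
  refine (Matrix.inv_eq_left_inv ?_).symm
  rw [← Matrix.map_mul, ← Units.val_mul, inv_mul_cancel, Units.val_one,
    Matrix.map_one f (map_zero f) (map_one f)]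

theorem det_map_ne_zero {L : Type*} [Field L] (f : F →+* L) {g : Matrix (Fin m) (Fin m) F}
    (hg : g.det ≠ 0) : (g.map f).det ≠ 0 := by
  rw [← RingHom.mapMatrix_apply, ← RingHom.map_det]
  exact (map_ne_zero f).2 hg

theorem det_GL_ne_zero (g : GL (Fin m) F) : (g : Matrix (Fin m) (Fin m) F).det ≠ 0 :=
  ((Matrix.isUnit_iff_isUnit_det _).1 g.isUnit).ne_zero

theorem gaugeInv_eq (g : GL (Fin m) F) : gaugeInv D n g =
    gauge ((g : Matrix (Fin m) (Fin m) F).map (algebraMap F (DiffRat F n m)))⁻¹ (ratDeriv D) := by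
  rw [gaugeInv, map_inv_eq]

theorem gauge_gaugeInv (g : GL (Fin m) F) :
    gauge ((g : Matrix (Fin m) (Fin m) F).map (algebraMap F (DiffRat F n m))) (gaugeInv D n g) =
      ratDeriv D := by
  rw [gaugeInv_eq, gauge_inv_cancel (det_map_ne_zero _ (det_GL_ne_zero g))]

theorem gaugeInv_comm (hD : ∀ i j a, D i (D j a) = D j (D i a)) {g : GL (Fin m) F}
    (hg : g ∈ GLd D) (i j : Fin m) (f : DiffRat F n m) :
    gaugeInv D n g i (gaugeInv D n g j f) = gaugeInv D n g j (gaugeInv D n g i f) := by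
  rw [gaugeInv_eq]
  refine gauge_inv_comm (det_map_ne_zero _ (det_GL_ne_zero g)) (ratDeriv_comm hD) ?_ i j f
  intro i j k
  rw [Matrix.map_apply, Matrix.map_apply, ratDeriv_algebraMap, ratDeriv_algebraMap, hg i j k]

theorem gaugeInv_algebraMap_mem (g : GL (Fin m) F) (k : Fin m) (a : F) :
    ∃ b, gaugeInv D n g k (algebraMap F _ a) = algebraMap F _ b := by
  refine ⟨∑ j, ((g⁻¹ : GL (Fin m) F) : Matrix (Fin m) (Fin m) F) k j * D j a, ?_⟩
  rw [gaugeInv, gauge_apply, map_sum]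
  simp [ratDeriv_algebraMap]

theorem gaugeInv_algebraMap_const (g : GL (Fin m) F) (k : Fin m) (c : constField D) :
    gaugeInv D n g k (algebraMap F _ (c : F)) = 0 := by
  rw [gaugeInv, gauge_apply]
  refine Finset.sum_eq_zero fun j _ => ?_
  rw [ratDeriv_algebraMap, c.2 j, map_zero, mul_zero]

theorem rowMul_apply (h : GL (Fin n) (constField D)) (i : Fin n) :
    rowMul (m := m) D h i = ∑ j, indet F j * algebraMap F _ (h j i : F) := rfl

theorem rowMul_inv_cancel (h : GL (Fin n) (constField D)) (i : Fin n) :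
    ∑ j, rowMul D h j * algebraMap F (DiffRat F n m) ((h⁻¹ : GL (Fin n) (constField D)) j i : F) =
      indet F i := by
  have h1 : Matrix.vecMul (rowMul (m := m) D h)
      (((h⁻¹ : GL (Fin n) (constField D)) : Matrix (Fin n) (Fin n) (constField D)).map
        ((algebraMap F (DiffRat F n m)).comp (constField D).subtype)) = indet F := by
    rw [rowMul, Matrix.vecMul_vecMul, ← Matrix.map_mul, ← Units.val_mul, mul_inv_cancel,
      Units.val_one, Matrix.map_one _ (map_zero _) (map_one _), Matrix.vecMul_one]
  exact congrFun h1 i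

/-- Inverting g and h expresses the jets of order at most N through the equally many elements
(g⁻¹∂)^α(xh) with |α| ≤ N, so independence of the former gives that of the latter. -/
theorem algebraicIndependent_iter_gaugeInv (hD : ∀ i j a, D i (D j a) = D j (D i a))
    {g : GL (Fin m) F} (hg : g ∈ GLd D) (h : GL (Fin n) (constField D)) :
    AlgebraicIndependent F fun p : Fin n × (Fin m → ℕ) =>
      iter (gaugeInv D n g) p.2 (rowMul D h p.1) := by
  classical
  set δ := gaugeInv D n g with hδdef
  have hδ := gaugeInv_comm (n := n) hD hg
  set S : ℕ → IntermediateField F (DiffRat F n m) := fun N => IntermediateField.adjoin F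
    (Set.range fun p : Fin n × multi m N => iter δ p.2.1 (rowMul D h p.1)) with hS
  have hmem : ∀ N (α : Fin m → ℕ) i, α ∈ multi m N → iter δ α (rowMul D h i) ∈ S N :=
    fun N α i hα => IntermediateField.subset_adjoin _ _ ⟨(i, ⟨α, hα⟩), rfl⟩
  have hmono : ∀ N, S N ≤ S (N + 1) := fun N => by
    refine IntermediateField.adjoin_le_iff.2 ?_
    rintro _ ⟨⟨i, α⟩, rfl⟩
    exact hmem _ _ _ (multi_mono (Nat.le_succ N) α.2)
  have hstep : ∀ N k, ∀ f ∈ S N, δ k f ∈ S (N + 1) := fun N k f hf => by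
    refine deriv_mem_of_mem_adjoin (δ k) (fun c => ?_)
      ((IntermediateField.subset_adjoin _ _).trans (hmono N)) ?_ hf
    · obtain ⟨b, hb⟩ := gaugeInv_algebraMap_mem (D := D) (n := n) g k c
      rw [hδdef, hb]
      exact IntermediateField.algebraMap_mem _ _
    · rintro _ ⟨⟨i, α⟩, rfl⟩
      dsimp only
      rw [← iter_add_single hδ]
      exact hmem _ _ _ (add_single_mem_multi α.2 k)
  have hjet : ∀ N, ∀ α ∈ multi m N, ∀ i, jet F i α ∈ S N := by
    intro N α hα i
    have h1 : indet F i ∈ S 0 := by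
      rw [← rowMul_inv_cancel h i]
      refine sum_mem fun j _ => mul_mem ?_ (IntermediateField.algebraMap_mem _ _)
      have := hmem 0 0 j (by simp [mem_multi])
      rwa [iter_zero] at this
    have hstep' : ∀ N, 0 ≤ N → ∀ k, ∀ f ∈ (S N : Set (DiffRat F n m)),
        ratDeriv D k f ∈ (S (N + 1) : Set (DiffRat F n m)) := fun N _ k f hf => by
      rw [← gauge_gaugeInv g, gauge_apply]
      exact sum_mem fun j _ => mul_mem (IntermediateField.algebraMap_mem _ _) (hstep N j f hf)
    have h2 := iter_mem_of_filtration (ratDeriv_comm hD) hstep' h1 α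
    rw [iter_ratDeriv_indet hD, zero_add] at h2
    have h3 : ∀ M, S (∑ i, α i) ≤ S (∑ i, α i + M) := fun M => by
      induction M with
      | zero => exact le_rfl
      | succ M ih => exact ih.trans (hmono _)
    have h4 := h3 (N - ∑ i, α i) h2
    rwa [Nat.add_sub_cancel' (mem_multi.1 hα)] at h4
  by_contra hcon
  obtain ⟨T, hT, -⟩ := exists_finset_minimal_dependent hcon
  refine hT ?_
  set N := T.sup fun p => ∑ i, p.2 i
  have hTN : ∀ p ∈ T, p.2 ∈ multi m N := fun p hp =>
    mem_multi.2 (Finset.le_sup (f := fun p : Fin n × (Fin m → ℕ) => ∑ i, p.2 i) hp)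
  have hind : AlgebraicIndependent F
      fun p : Fin n × multi m N => iter δ p.2.1 (rowMul D h p.1) := by
    refine algebraicIndependent_of_card_le (κ := Fin n × multi m N)
      (b := fun p => jet F p.1 p.2.1) ?_ (fun p => ?_) le_rfl
    · exact algebraicIndependent_jet.comp
        (fun p : Fin n × multi m N => ((p.1, p.2.1) : Fin n × (Fin m → ℕ)))
        fun p q hpq => by
          simp only [Prod.mk.injEq] at hpq
          exact Prod.ext hpq.1 (Subtype.ext hpq.2)
    · exact adjoin_le_acl _ (hjet N _ p.2.2 p.1)
  exact hind.comp (fun p : (T : Set (Fin n × (Fin m → ℕ))) => (p.1.1, ⟨p.1.2, hTN p.1 p.2⟩))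
    fun p q hpq => by
      simp only [Prod.mk.injEq, Subtype.mk.injEq] at hpq
      exact Subtype.ext (Prod.ext hpq.1 hpq.2)

theorem polySubst_injective (hD : ∀ i j a, D i (D j a) = D j (D i a))
    {g : GL (Fin m) F} (hg : g ∈ GLd D) (h : GL (Fin n) (constField D)) :
    Function.Injective (polySubst D (gaugeInv D n g) (rowMul D h)) := by
  have h1 : polySubst D (gaugeInv D n g) (rowMul D h) =
      ((MvPolynomial.aeval fun p : Fin n × (Fin m → ℕ) =>
        iter (gaugeInv D n g) p.2 (rowMul D h p.1) : _ →ₐ[F] DiffRat F n m) : _ →+* _).comp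
        (MvPolynomial.map (constField D).subtype) := by
    refine MvPolynomial.ringHom_ext (fun c => ?_) fun p => ?_
    · simp [polySubst]
    · simp [polySubst]
  rw [h1, RingHom.coe_comp]
  exact Function.Injective.comp (algebraicIndependent_iter_gaugeInv hD hg h)
    (MvPolynomial.map_injective _ (constField D).subtype_injective)

/-- The homomorphism `f ↦ f^(g⁻¹∂)⟨xh⟩`. -/
def substHom (hD : ∀ i j a, D i (D j a) = D j (D i a)) {g : GL (Fin m) F} (hg : g ∈ GLd D)
    (h : GL (Fin n) (constField D)) : CRat D n →+* DiffRat F n m :=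
  IsFractionRing.lift (polySubst_injective hD hg h)

section

variable (hD : ∀ i j a, D i (D j a) = D j (D i a)) {g : GL (Fin m) F} (hg : g ∈ GLd D)
  (h : GL (Fin n) (constField D))

/-- Substitution into polynomials is injective, hence extends to a field homomorphism, and the
reduced fraction used in `ratSubst` gives its value. -/
theorem ratSubst_eq_substHom (f : CRat D n) :
    ratSubst D (gaugeInv D n g) (rowMul D h) f = substHom hD hg h f := by
  have h1 := IsFractionRing.mk'_num_den' (DiffPoly (constField D) n m) f
  conv_rhs => rw [← h1, map_div₀]
  rw [substHom, IsFractionRing.lift_algebraMap, IsFractionRing.lift_algebraMap]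
  rfl

theorem substHom_algebraMap (c : constField D) :
    substHom hD hg h (algebraMap _ _ c) = algebraMap F _ (c : F) := by
  rw [IsScalarTower.algebraMap_apply (constField D) (DiffPoly (constField D) n m), substHom,
    IsFractionRing.lift_algebraMap]
  simp [polySubst, MvPolynomial.algebraMap_eq]

theorem substHom_jet (i : Fin n) (α : Fin m → ℕ) :
    substHom hD hg h (jet _ i α) = iter (gaugeInv D n g) α (rowMul D h i) := by
  rw [jet, substHom, IsFractionRing.lift_algebraMap]
  simp [polySubst]

theorem substHom_indet (i : Fin n) :
    substHom hD hg h (indet _ i) = rowMul D h i := by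
  rw [indet, substHom_jet, iter_zero]

theorem cDeriv_comm (i j : Fin m) (f : CRat D n) :
    cDeriv D n i (cDeriv D n j f) = cDeriv D n j (cDeriv D n i f) :=
  ratDeriv_comm (fun _ _ _ => rfl) i j f

theorem cDeriv_algebraMap (k : Fin m) (c : constField D) :
    cDeriv D n k (algebraMap _ _ c) = 0 := by
  rw [cDeriv, ratDeriv_algebraMap]
  exact map_zero _

theorem substHom_cDeriv (k : Fin m) (f : CRat D n) :
    substHom hD hg h (cDeriv D n k f) = gaugeInv D n g k (substHom hD hg h f) := by
  induction f using diffRat_induction with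
  | algebraMap c =>
    rw [cDeriv_algebraMap, map_zero, substHom_algebraMap, gaugeInv_algebraMap_const]
  | jet i α =>
    rw [cDeriv, ratDeriv_jet, substHom_jet, substHom_jet,
      iter_add_single (gaugeInv_comm hD hg)]
  | add f₁ f₂ h₁ h₂ => rw [map_add, map_add, map_add, map_add, h₁, h₂]
  | mul f₁ f₂ h₁ h₂ =>
    rw [Derivation.leibniz, map_mul, Derivation.leibniz, map_add]
    simp only [smul_eq_mul, map_mul, h₁, h₂]
  | inv f hf =>
    rw [Derivation.leibniz_inv, map_inv₀, Derivation.leibniz_inv]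
    simp only [smul_eq_mul, map_mul, map_neg, map_pow, map_inv₀, hf]

end

theorem one_mem_GLd (D : Fin m → Der F) : 1 ∈ GLd D := fun i j k => by
  have h : ∀ i j k : Fin m, D i ((1 : Matrix (Fin m) (Fin m) F) j k) = 0 := fun i j k => by
    rw [Matrix.one_apply]
    split_ifs <;> simp
  change D i ((1 : Matrix (Fin m) (Fin m) F) j k) = D j ((1 : Matrix (Fin m) (Fin m) F) i k)
  rw [h, h]

theorem gaugeInv_one (D : Fin m → Der F) : gaugeInv D n 1 = ratDeriv D := by
  have h := gauge_gaugeInv (D := D) (n := n) 1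
  rwa [Units.val_one, Matrix.map_one _ (map_zero _) (map_one _), gauge_one] at h

theorem rowMul_one (D : Fin m → Der F) :
    rowMul (m := m) D (1 : GL (Fin n) (constField D)) = indet F := by
  rw [rowMul, Units.val_one, Matrix.map_one _ (map_zero _) (map_one _), Matrix.vecMul_one]

/-- The inclusion of `C⟨x; ∂⟩` in `F⟨x; ∂⟩`. -/
def inclHom (hD : ∀ i j a, D i (D j a) = D j (D i a)) (n : ℕ) : CRat D n →+* DiffRat F n m :=
  substHom hD (one_mem_GLd D) 1

section

variable (hD : ∀ i j a, D i (D j a) = D j (D i a))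

theorem ratSubst_eq_inclHom (f : CRat D n) :
    ratSubst D (ratDeriv D) (indet F) f = inclHom hD n f := by
  rw [inclHom, ← ratSubst_eq_substHom, gaugeInv_one, rowMul_one]

theorem inclHom_algebraMap (c : constField D) :
    inclHom hD n (algebraMap _ _ c) = algebraMap F _ (c : F) :=
  substHom_algebraMap hD _ _ c

theorem inclHom_indet (i : Fin n) : inclHom hD n (indet _ i) = indet F i := by
  rw [inclHom, substHom_indet, rowMul_one]

theorem inclHom_cDeriv (k : Fin m) (f : CRat D n) :
    inclHom hD n (cDeriv D n k f) = ratDeriv D k (inclHom hD n f) := by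
  rw [inclHom, substHom_cDeriv, gaugeInv_one]

end

end Substitution

/-! ### A generic Jacobian substitution in an ultrapower. -/

section GenericPoint

open Filter

variable {F : Type*} [Field F] {m n : ℕ} {D : Fin m → Der F}

/-- An ultrafilter on `F^m` that contains the nonvanishing sets of all nonzero differential
polynomials over an extension `E` of `F`. -/
theorem exists_generic_ultrafilter [CharZero F] (hD : ∀ i j a, D i (D j a) = D j (D i a))
    (hlin : LinearIndependent F D) (κ E : Type*) [Field E] [Algebra F E] :
    ∃ U : Ultrafilter (κ → F), ∀ P : MvPolynomial (κ × (Fin m → ℕ)) E, P ≠ 0 →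
      ∀ᶠ z in (U : Filter (κ → F)),
        MvPolynomial.eval (fun p => algebraMap F E (iter D p.2 (z p.1))) P ≠ 0 := by
  -- Closed under intersection because a product of nonzero polynomials is nonzero, and proper by
  -- `exists_eval_iter_ne_zero`.
  let l : Filter (κ → F) :=
    { sets := {s | ∃ P : MvPolynomial (κ × (Fin m → ℕ)) E, P ≠ 0 ∧
        ∀ z, MvPolynomial.eval (fun p => algebraMap F E (iter D p.2 (z p.1))) P ≠ 0 → z ∈ s}
      univ_sets := ⟨1, one_ne_zero, fun z _ => Set.mem_univ z⟩
      sets_of_superset := by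
        rintro s t ⟨P, hP, h⟩ hst
        exact ⟨P, hP, fun z hz => hst (h z hz)⟩
      inter_sets := by
        rintro s t ⟨P, hP, h⟩ ⟨Q, hQ, h'⟩
        refine ⟨P * Q, mul_ne_zero hP hQ, fun z hz => ?_⟩
        rw [map_mul] at hz
        exact ⟨h z (left_ne_zero_of_mul hz), h' z (right_ne_zero_of_mul hz)⟩ }
  have hl : l.NeBot := by
    refine ⟨fun hbot => ?_⟩
    have h0 : (∅ : Set (κ → F)) ∈ l := by
      rw [hbot]
      exact mem_bot
    obtain ⟨P, hP, h⟩ := h0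
    obtain ⟨z, hz⟩ := exists_eval_iter_ne_zero hD hlin hP
    exact h z hz
  exact ⟨Ultrafilter.of l, fun P hP => Ultrafilter.of_le l ⟨P, hP, fun _ hz => hz⟩⟩

/-- The ultrapower of a field. -/
theorem exists_ultrapower {I E : Type u} [Field E] (U : Ultrafilter I) :
    ∃ (G : Type u) (_ : Field G) (q : (I → E) →+* G), Function.Surjective q ∧
      ∀ f f', q f = q f' ↔ ∀ᶠ z in (U : Filter I), f z = f' z :=
  ⟨Germ (U : Filter I) E, inferInstance, Germ.coeRingHom (U : Filter I),
    fun a => Germ.inductionOn a fun f => ⟨f, rfl⟩, fun _ _ => Germ.coe_eq⟩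

/-- A derivation extends to an ultrapower. -/
theorem exists_ultrapower_deriv {I E G : Type*} [Field E] [Field G] {U : Ultrafilter I}
    {q : (I → E) →+* G} (hq : Function.Surjective q)
    (hU : ∀ f f', q f = q f' ↔ ∀ᶠ z in (U : Filter I), f z = f' z) (d : Der E) :
    ∃ Δ : Der G, ∀ f, Δ (q f) = q fun z => d (f z) := by
  let s := Function.surjInv hq
  have hs : ∀ a, q (s a) = a := Function.surjInv_eq hq
  have hwd : ∀ f f', q f = q f' → q (fun z => d (f z)) = q fun z => d (f' z) := by
    intro f f' h
    rw [hU] at h ⊢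
    filter_upwards [h] with z hz
    rw [hz]
  have hadd : ∀ a b, q (fun z => d (s (a + b) z)) =
      q (fun z => d (s a z)) + q fun z => d (s b z) := fun a b => by
    rw [hwd (s (a + b)) (s a + s b) (by rw [map_add, hs, hs, hs]), ← map_add]
    refine congrArg q (funext fun z => ?_)
    simp
  have hmul : ∀ a b, q (fun z => d (s (a * b) z)) =
      a * q (fun z => d (s b z)) + b * q fun z => d (s a z) := fun a b => by
    have h1 : a * q (fun z => d (s b z)) + b * q (fun z => d (s a z)) =
        q (s a * (fun z => d (s b z)) + s b * fun z => d (s a z)) := by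
      rw [map_add, map_mul, map_mul, hs, hs]
    rw [hwd (s (a * b)) (s a * s b) (by rw [map_mul, hs, hs, hs]), h1]
    refine congrArg q (funext fun z => ?_)
    simp
  let T : G →+ G := AddMonoidHom.mk' (fun a => q fun z => d (s a z)) hadd
  exact ⟨Derivation.mk' T.toIntLinearMap fun a b => hmul a b, fun f => hwd _ _ (hs _)⟩

/-- The matrix `(∂_i z_j)`. -/
def jacobian {L : Type*} [Field L] (Δ : Fin m → Der L) (z : Fin m → L) :
    Matrix (Fin m) (Fin m) L := Matrix.of fun i j => Δ i (z j)

/-- The entries are distinct variables, so this is the generic determinant renamed. It makes almost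
every Jacobian invertible. -/
theorem det_jacobian_poly_ne_zero (m : ℕ) (E : Type*) [Field E] :
    (Matrix.of fun i j => (MvPolynomial.X (j, Pi.single i 1) :
      MvPolynomial (Fin m × (Fin m → ℕ)) E)).det ≠ 0 := by
  have hinj : Function.Injective
      fun p : Fin m × Fin m => ((p.2, Pi.single p.1 1) : Fin m × (Fin m → ℕ)) := by
    intro p q hpq
    simp only [Prod.mk.injEq] at hpq
    refine Prod.ext ?_ hpq.1
    by_contra hne
    have := congrFun hpq.2 p.1
    rw [Pi.single_eq_same, Pi.single_eq_of_ne hne] at this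
    exact one_ne_zero this
  have h1 : (Matrix.of fun i j => (MvPolynomial.X (j, Pi.single i 1) :
      MvPolynomial (Fin m × (Fin m → ℕ)) E)) =
      (MvPolynomial.rename fun p : Fin m × Fin m =>
        ((p.2, Pi.single p.1 1) : Fin m × (Fin m → ℕ))).mapMatrix
        (Matrix.mvPolynomialX (Fin m) (Fin m) E) := by
    ext1 i j
    simp [Matrix.mvPolynomialX_apply]
  rw [h1, ← AlgHom.map_det]
  intro h0
  rw [← map_zero (MvPolynomial.rename fun p : Fin m × Fin m =>
        ((p.2, Pi.single p.1 1) : Fin m × (Fin m → ℕ)))] at h0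
  exact Matrix.det_mvPolynomialX_ne_zero (Fin m) E (MvPolynomial.rename_injective _ hinj h0)

theorem iter_single {L : Type*} [Field L] {Δ : Fin m → Der L}
    (hΔ : ∀ i j a, Δ i (Δ j a) = Δ j (Δ i a)) (k : Fin m) (a : L) :
    iter Δ (Pi.single k 1) a = Δ k a := by
  rw [← zero_add (Pi.single k 1), iter_add_single hΔ, iter_zero]

/-- A generic change of the independent variables: a differential extension `G` of `F⟨x; ∂⟩`
with differentially independent elements `z_1, …, z_m` and the substitution `∂ ↦ Z⁻¹∂` with
`Z = (∂_i z_j)`. -/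
theorem exists_generic_substitution {F : Type u} [Field F] [CharZero F] {D : Fin m → Der F}
    (hD : ∀ i j a, D i (D j a) = D j (D i a)) (hlin : LinearIndependent F D) (n : ℕ) :
    ∃ (G : Type u) (_ : Field G) (_ : Algebra (DiffRat F n m) G) (Δ : Fin m → Der G)
      (z : Fin m → G) (φ : CRat D n →+* G),
      (∀ i j a, Δ i (Δ j a) = Δ j (Δ i a)) ∧
      (∀ k f, Δ k (algebraMap (DiffRat F n m) G f) = algebraMap _ G (ratDeriv D k f)) ∧
      AlgebraicIndependent (DiffRat F n m)
        (fun p : Fin m × (Fin m → ℕ) => iter Δ p.2 (z p.1)) ∧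
      (∀ i f, Δ i (φ f) = ∑ k, jacobian Δ z i k * φ (cDeriv D n k f)) ∧
      (∀ f, (∀ g, ∀ hg : g ∈ GLd D, substHom hD hg 1 f = inclHom hD n f) →
        φ f = algebraMap _ G (inclHom hD n f)) ∧
      (∀ M : Matrix (Fin m) (Fin m) (CRat D n), (∀ g, ∀ hg : g ∈ GLd D,
        (g : Matrix (Fin m) (Fin m) F).map (algebraMap F (DiffRat F n m)) *
          M.map (substHom hD hg 1) = M.map (inclHom hD n)) →
        jacobian Δ z * M.map φ = (M.map (inclHom hD n)).map (algebraMap _ G)) := by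
  classical
  obtain ⟨U, hU⟩ := exists_generic_ultrafilter hD hlin (Fin m) (DiffRat F n m)
  obtain ⟨G, _, q, hq, hqU⟩ := exists_ultrapower (E := DiffRat F n m) U
  let _ : Algebra (DiffRat F n m) G :=
    (q.comp (Pi.constRingHom (Fin m → F) (DiffRat F n m))).toAlgebra
  choose Δ hΔq using fun k => exists_ultrapower_deriv hq hqU (ratDeriv D k)
  let z : Fin m → G := fun j => q fun z => algebraMap F (DiffRat F n m) (z j)
  have hqeq : ∀ {f f' : (Fin m → F) → DiffRat F n m},
      (∀ᶠ z in (U : Filter (Fin m → F)), f z = f' z) →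
      q f = q f' := fun h => (hqU _ _).2 h
  have halg : ∀ f : (DiffRat F n m), algebraMap (DiffRat F n m) G f = q fun _ => f := fun f => rfl
  have hΔcomm : ∀ i j a, Δ i (Δ j a) = Δ j (Δ i a) := fun i j a => by
    obtain ⟨a, rfl⟩ := hq a
    rw [hΔq, hΔq, hΔq, hΔq]
    refine congrArg q (funext fun z => ?_)
    rw [ratDeriv_comm hD]
  have hiter : ∀ α j, iter Δ α (z j) =
      q fun z => algebraMap F (DiffRat F n m) (iter D α (z j)) := by
    intro α j
    induction α using multi_induction with
    | zero => simp only [iter_zero]; rfl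
    | add_single α k ih =>
      rw [iter_add_single hΔcomm, ih, hΔq]
      refine congrArg q (funext fun z => ?_)
      rw [ratDeriv_algebraMap, iter_add_single hD]
  let J : (Fin m → F) → Matrix (Fin m) (Fin m) F := fun z => jacobian D z
  have hJcl : ∀ z i j k, D i (J z j k) = D j (J z i k) := fun z i j k => hD i j (z k)
  have hJdet : ∀ᶠ z in (U : Filter (Fin m → F)), (J z).det ≠ 0 := by
    filter_upwards [hU _ (det_jacobian_poly_ne_zero m (DiffRat F n m))] with z hz h0
    refine hz ?_
    rw [RingHom.map_det]
    have h1 : (MvPolynomial.eval fun p : Fin m × (Fin m → ℕ) =>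
        algebraMap F (DiffRat F n m) (iter D p.2 (z p.1))).mapMatrix (Matrix.of fun i j =>
          (MvPolynomial.X (j, Pi.single i 1) :
            MvPolynomial (Fin m × (Fin m → ℕ)) (DiffRat F n m))) =
        (algebraMap F (DiffRat F n m)).mapMatrix (J z) := by
      ext1 i j
      simp [J, jacobian, iter_single hD]
    rw [h1, ← RingHom.map_det, h0, map_zero]
  have hmem : ∀ (z : Fin m → F) (hz : (J z).det ≠ 0),
      Matrix.GeneralLinearGroup.mkOfDetNeZero (J z) hz ∈ GLd D := fun z _ i j k => hJcl z i j k
  -- The inclusion is a default where the Jacobian is singular; the ultrafilter ignores those z.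
  let Φ : (Fin m → F) → (CRat D n →+* (DiffRat F n m)) := fun z =>
    if hz : (J z).det ≠ 0 then substHom hD (hmem z hz) 1 else inclHom hD n
  let φ : CRat D n →+* G := q.comp (RingHom.pi Φ)
  have hφ : ∀ f, φ f = q fun z => Φ z f := fun f => rfl
  have hΦ : ∀ᶠ z in (U : Filter (Fin m → F)), ∃ g : GL (Fin m) F, ∃ hg : g ∈ GLd D,
      (g : Matrix (Fin m) (Fin m) F) = J z ∧ Φ z = substHom hD hg 1 := by
    filter_upwards [hJdet] with z hz
    exact ⟨_, hmem z hz, rfl, dif_pos hz⟩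
  have hjac : ∀ i k, jacobian Δ z i k =
      q fun z => algebraMap F (DiffRat F n m) (J z i k) := fun i k => by
    change Δ i (z k) = _
    rw [hΔq]
    refine congrArg q (funext fun z => ?_)
    exact ratDeriv_algebraMap D i (z k)
  have hqsum : ∀ f f' : Fin m → (Fin m → F) → DiffRat F n m,
      ∑ k, q (f k) * q (f' k) = q fun z => ∑ k, f k z * f' k z := fun f f' => by
    simp_rw [← map_mul]
    rw [← map_sum]
    refine congrArg q (funext fun z => ?_)
    simp
  refine ⟨G, inferInstance, inferInstance, Δ, z, φ, hΔcomm, fun k f => hΔq k _, ?_, ?_, ?_, ?_⟩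
  -- A relation P between the derivatives of the generic z would hold at almost all z in F^m,
  -- contrary to the choice of U.
  · rw [algebraicIndependent_iff]
    intro P hP
    by_contra hP0
    have h1 : ((MvPolynomial.aeval fun p : Fin m × (Fin m → ℕ) => iter Δ p.2 (z p.1) :
        MvPolynomial (Fin m × (Fin m → ℕ)) (DiffRat F n m) →ₐ[(DiffRat F n m)] G) :
        MvPolynomial (Fin m × (Fin m → ℕ)) (DiffRat F n m) →+* G) =
        q.comp (RingHom.pi fun z : Fin m → F =>
          MvPolynomial.eval fun p : Fin m × (Fin m → ℕ) =>
            algebraMap F (DiffRat F n m) (iter D p.2 (z p.1))) := by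
      refine MvPolynomial.ringHom_ext (fun c => ?_) fun p => ?_
      · simp only [RingHom.coe_coe, MvPolynomial.aeval_C, RingHom.comp_apply, halg]
        exact congrArg q (funext fun z => (MvPolynomial.eval_C c).symm)
      · simp only [RingHom.coe_coe, MvPolynomial.aeval_X, RingHom.comp_apply, hiter]
        exact congrArg q (funext fun z => (MvPolynomial.eval_X
          (f := fun p : Fin m × (Fin m → ℕ) =>
            algebraMap F (DiffRat F n m) (iter D p.2 (z p.1))) p).symm)
    have h2 : (q.comp (RingHom.pi fun z : Fin m → F =>
          MvPolynomial.eval fun p : Fin m × (Fin m → ℕ) =>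
            algebraMap F (DiffRat F n m) (iter D p.2 (z p.1)))) P = 0 := by
      rw [← h1]
      exact hP
    have h3 : ∀ᶠ z in (U : Filter (Fin m → F)),
        MvPolynomial.eval (fun p => algebraMap F (DiffRat F n m) (iter D p.2 (z p.1))) P = 0 :=
      (hqU _ 0).1 (h2.trans (map_zero q).symm)
    obtain ⟨z, h4, h5⟩ := (h3.and (hU P hP0)).exists
    exact h5 h4
  · intro i f
    simp only [hjac, hφ, hΔq, hqsum]
    refine hqeq ?_
    filter_upwards [hΦ] with z ⟨g, hg, hgJ, hz⟩
    rw [hz, ← gauge_gaugeInv g, gauge_apply]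
    simp only [Matrix.map_apply, hgJ]
    exact Finset.sum_congr rfl fun k _ => by rw [substHom_cDeriv]
  · intro f hf
    rw [hφ, halg]
    refine hqeq ?_
    filter_upwards [hΦ] with z ⟨g, hg, hgJ, hz⟩
    rw [hz, hf g hg]
  · intro M hM
    ext i j
    rw [Matrix.mul_apply]
    simp only [hjac, Matrix.map_apply, hφ, hqsum]
    refine hqeq ?_
    filter_upwards [hΦ] with z ⟨g, hg, hgJ, hz⟩
    have h1 := congrFun (congrFun (hM g hg) i) j
    rw [Matrix.mul_apply] at h1
    simp only [Matrix.map_apply, hgJ] at h1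
    rw [hz, h1]
    rfl

end GenericPoint

/-! ### Matrix inverses under field homomorphisms and in subfields. -/

section Matrices

variable {m : ℕ}

theorem map_matrix_inv {L L' : Type*} [Field L] [Field L'] (φ : L →+* L')
    {A : Matrix (Fin m) (Fin m) L} (hA : A.det ≠ 0) : (A.map φ)⁻¹ = A⁻¹.map φ := by
  refine Matrix.inv_eq_left_inv ?_
  rw [← Matrix.map_mul, Matrix.nonsing_inv_mul _ (isUnit_iff_ne_zero.2 hA),
    Matrix.map_one _ (map_zero _) (map_one _)]

theorem inv_apply_mem {k L : Type*} [Field k] [Field L] [Algebra k L] {K : IntermediateField k L}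
    {A : Matrix (Fin m) (Fin m) L} (hA : A.det ≠ 0) (h : ∀ i j, A i j ∈ K) (i j : Fin m) :
    A⁻¹ i j ∈ K := by
  set B : Matrix (Fin m) (Fin m) K := Matrix.of fun i j => ⟨A i j, h i j⟩ with hB
  have h1 : A = B.map (algebraMap K L) := rfl
  have h2 : B.det ≠ 0 := by
    intro h0
    rw [h1, ← RingHom.mapMatrix_apply, ← RingHom.map_det, h0, map_zero] at hA
    exact hA rfl
  rw [h1, map_matrix_inv _ h2]
  exact (B⁻¹ i j).2

end Matrices

/-! ### The system δ = M⁻¹∂. -/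

section InvariantDerivations

variable {F : Type*} [Field F] {m n : ℕ} {D : Fin m → Der F}
  {M : Matrix (Fin m) (Fin m) (CRat D n)}

theorem invDeriv_algebraMap (M : Matrix (Fin m) (Fin m) (CRat D n)) (k : Fin m)
    (c : constField D) : invDeriv D M k (algebraMap _ _ c) = 0 := by
  rw [invDeriv, gauge_apply]
  exact Finset.sum_eq_zero fun j _ => by rw [cDeriv_algebraMap, mul_zero]

theorem cDeriv_eq_sum (hdet : M.det ≠ 0) (k : Fin m) (f : CRat D n) :
    cDeriv D n k f = ∑ l, M k l * invDeriv D M l f := by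
  rw [← gauge_apply, invDeriv, gauge_inv_cancel hdet]

theorem invDeriv_comm (hdet : M.det ≠ 0)
    (hsymm : ∀ i j k, cDeriv D n k (M i j) = cDeriv D n i (M k j)) (i j : Fin m) (f : CRat D n) :
    invDeriv D M i (invDeriv D M j f) = invDeriv D M j (invDeriv D M i f) :=
  gauge_inv_comm hdet cDeriv_comm (fun i j k => hsymm j k i) i j f

/-- Once the order is at least that of the entries of M⁻¹, each δ_k raises it by at most one. This
unit slope keeps the leading coefficients comparable. -/
theorem exists_iter_invDeriv_mem_jetField (hdet : M.det ≠ 0)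
    (hsymm : ∀ i j k, cDeriv D n k (M i j) = cDeriv D n i (M k j)) {ι : Type*} [Finite ι]
    (f : ι → CRat D n) :
    ∃ c, ∀ N, ∀ α ∈ multi m N, ∀ i,
      iter (invDeriv D M) α (f i) ∈ jetField (constField D) n m (N + c) := by
  obtain ⟨c, hc⟩ := exists_forall_mem_jetField
    (Sum.elim f fun p : Fin m × Fin m => M⁻¹ p.1 p.2)
  refine ⟨c, fun N α hα i => ?_⟩
  have hstep : ∀ N, c ≤ N → ∀ k, ∀ f ∈ (jetField (constField D) n m N : Set (CRat D n)),
      invDeriv D M k f ∈ (jetField (constField D) n m (N + 1) : Set (CRat D n)) :=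
    fun N hN k f hf => by
      rw [invDeriv, gauge_apply]
      exact sum_mem fun l _ => mul_mem
        (jetField_mono (hN.trans (Nat.le_succ N)) (hc (Sum.inr (k, l))))
        (ratDeriv_mem_jetField _ l hf)
  have h1 := iter_mem_of_filtration (invDeriv_comm hdet hsymm) hstep (hc (Sum.inl i)) α
  exact jetField_mono (by have := mem_multi.1 hα; omega) h1

/-- A substitution under which `M` transforms as a frame maps `δ = M⁻¹∂` to the system `M⁻¹∂` of
the target. -/
theorem map_invDeriv {L : Type*} [Field L] {Δ : Fin m → Der L} {φ : CRat D n →+* L}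
    {Z M' : Matrix (Fin m) (Fin m) L} (hdet : M.det ≠ 0) (hM' : M'.det ≠ 0)
    (hφ : ∀ i f, Δ i (φ f) = ∑ k, Z i k * φ (cDeriv D n k f)) (hZ : Z * M.map φ = M')
    (k : Fin m) (f : CRat D n) : φ (invDeriv D M k f) = gauge M'⁻¹ Δ k (φ f) := by
  -- Chain of identities: Δφ = Z·φ(∂) = Z·φ(M)·φ(δ) = M'·φ(δ).
  have h1 : (fun i => Δ i (φ f)) = M'.mulVec fun l => φ (invDeriv D M l f) := by
    ext i
    rw [hφ, ← hZ, ← Matrix.mulVec_mulVec]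
    refine Finset.sum_congr rfl fun k _ => ?_
    rw [cDeriv_eq_sum hdet, map_sum]
    simp [Matrix.mulVec, dotProduct]
  have h2 := congrArg (M'⁻¹.mulVec) h1
  rw [Matrix.mulVec_mulVec, Matrix.nonsing_inv_mul _ (isUnit_iff_ne_zero.2 hM'),
    Matrix.one_mulVec] at h2
  rw [gauge_apply]
  exact (congrFun h2 k).symm

end InvariantDerivations

/-! ### At most n - m independent invariants. -/

section UpperBound

variable {F : Type u} [Field F] [CharZero F] {m n : ℕ} {D : Fin m → Der F}
  {M : Matrix (Fin m) (Fin m) (CRat D n)}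

/-- The functions that do not change under the substitutions `∂ ↦ g⁻¹∂` have `δ`-transcendence
degree at most `n - m`. -/
theorem add_le_of_diffAlgIndep (hm : 0 < m) (hD : ∀ i j a, D i (D j a) = D j (D i a))
    (hlin : LinearIndependent F D) (hdet : M.det ≠ 0)
    (hsymm : ∀ i j k, cDeriv D n k (M i j) = cDeriv D n i (M k j))
    (hequiv : ∀ g, ∀ hg : g ∈ GLd D,
        (g : Matrix (Fin m) (Fin m) F).map (algebraMap F (DiffRat F n m)) *
          M.map (substHom hD hg 1) = M.map (inclHom hD n))
    {d : ℕ} {y : Fin d → CRat D n}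
    (hy : ∀ j g, ∀ hg : g ∈ GLd D, substHom hD hg 1 (y j) = inclHom hD n (y j))
    (hind : DiffAlgIndep (constField D) (invDeriv D M) y) : d + m ≤ n := by
  obtain ⟨G, _, _, Δ, z, φ, hΔ, hΔalg, hz, hφΔ, hφinv, hφM⟩ :=
    exists_generic_substitution hD hlin n
  set E := DiffRat F n m
  set ME : Matrix (Fin m) (Fin m) E := M.map (inclHom hD n) with hME
  set MG : Matrix (Fin m) (Fin m) G := ME.map (algebraMap E G) with hMG
  set Z := jacobian Δ z with hZ
  have hMEdet : ME.det ≠ 0 := det_map_ne_zero _ hdet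
  have hMGdet : MG.det ≠ 0 := det_map_ne_zero _ hMEdet
  have hZM : Z * M.map φ = MG := hφM M hequiv
  have hMφdet : (M.map φ).det ≠ 0 := det_map_ne_zero _ hdet
  set δ := invDeriv D M with hδ
  set δG := gauge MG⁻¹ Δ with hδG
  have hδcomm := invDeriv_comm hdet hsymm
  have hφδ : ∀ k f, φ (δ k f) = δG k (φ f) := map_invDeriv hdet hMGdet hφΔ hZM
  have hincl : ∀ k f, inclHom hD n (δ k f) = gauge ME⁻¹ (ratDeriv D) k (inclHom hD n f) :=
    map_invDeriv (Z := 1) hdet hMEdet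
      (fun i f => by simp [Matrix.one_apply, inclHom_cDeriv]) (Matrix.one_mul _)
  have hδGalg : ∀ k f, δG k (algebraMap E G f) =
      algebraMap E G (gauge ME⁻¹ (ratDeriv D) k f) := fun k f => by
    rw [hδG, gauge_apply, gauge_apply, hMG, map_matrix_inv _ hMEdet, map_sum]
    simp only [Matrix.map_apply, map_mul]
    exact Finset.sum_congr rfl fun j _ => congrArg _ (hΔalg j f)
  -- Both φ and the inclusion carry δ to `δG`, so their agreement on y_j passes to all derivatives.
  have hyfix : ∀ j α, φ (iter δ α (y j)) = algebraMap E G (inclHom hD n (iter δ α (y j))) := by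
    intro j α
    rw [map_iter φ hφδ, map_iter (inclHom hD n) hincl,
      map_iter (algebraMap E G) (fun k f => (hδGalg k f).symm), hφinv _ (hy j)]
  -- The field generated by the images of the derivatives of `M`.
  let gen : ∀ N, Fin m × Fin m × multi m N → CRat D n := fun N p => iter δ p.2.2.1 (M p.1 p.2.1)
  let S : ℕ → IntermediateField E G := fun N =>
    IntermediateField.adjoin E (Set.range (φ ∘ gen N))
  have hmem : ∀ N (α : Fin m → ℕ) i j, α ∈ multi m N → φ (iter δ α (M i j)) ∈ S N :=
    fun N α i j hα => IntermediateField.subset_adjoin _ _ ⟨(i, j, ⟨α, hα⟩), rfl⟩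
  have hmono : ∀ N, S N ≤ S (N + 1) := fun N => by
    refine IntermediateField.adjoin_le_iff.2 ?_
    rintro _ ⟨⟨i, j, α⟩, rfl⟩
    exact hmem _ _ _ _ (multi_mono (Nat.le_succ N) α.2)
  have hstep : ∀ N k, ∀ f ∈ S N, δG k f ∈ S (N + 1) := fun N k f hf => by
    refine deriv_mem_of_mem_adjoin (δG k) (fun c => ?_)
      ((IntermediateField.subset_adjoin _ _).trans (hmono N)) ?_ hf
    · rw [hδGalg]
      exact IntermediateField.algebraMap_mem _ _
    · rintro _ ⟨⟨i, j, α⟩, rfl⟩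
      simp only [Function.comp, gen]
      rw [← hφδ, ← iter_add_single hδcomm]
      exact hmem _ _ _ _ (add_single_mem_multi α.2 k)
  have hstepΔ : ∀ N, 0 ≤ N → ∀ k, ∀ f ∈ (S N : Set G), Δ k f ∈ (S (N + 1) : Set G) :=
    fun N _ k f hf => by
      rw [← gauge_inv_cancel hMGdet Δ, gauge_apply]
      exact sum_mem fun l _ => mul_mem (IntermediateField.algebraMap_mem _ _) (hstep N l f hf)
  have hmono' : ∀ N M, S N ≤ S (N + M) := fun N M => by
    induction M with
    | zero => exact le_rfl
    | succ M ih => exact ih.trans (hmono _)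
  -- Z = M·φ(M)⁻¹, where M has entries in the base field E.
  have hZmem : ∀ i j, Z i j ∈ S 0 := fun i j => by
    have h1 : Z = MG * (M.map φ)⁻¹ := by
      rw [← hZM, Matrix.mul_assoc, Matrix.mul_nonsing_inv _ (isUnit_iff_ne_zero.2 hMφdet),
        Matrix.mul_one]
    rw [h1, Matrix.mul_apply]
    refine sum_mem fun k _ => mul_mem (IntermediateField.algebraMap_mem _ _)
      (inv_apply_mem hMφdet (fun i j => ?_) k j)
    have h2 := hmem 0 0 i j (by simp [mem_multi])
    rwa [iter_zero] at h2
  let k₀ : Fin m := ⟨0, hm⟩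
  -- Only first derivatives of z occur in Z, hence the extra ∂_(k₀). For each j it still leaves B(N)
  -- distinct derivatives.
  have hzmem : ∀ N, ∀ α ∈ multi m N, ∀ j, iter Δ (α + Pi.single k₀ 1) (z j) ∈ S N := by
    intro N α hα j
    have h1 := iter_mem_of_filtration hΔ hstepΔ (hZmem k₀ j) α
    rw [hZ, jacobian, Matrix.of_apply, ← map_iter (Δ k₀) (fun k a => hΔ k₀ k a),
      ← iter_add_single hΔ, zero_add] at h1
    have h2 := hmono' _ (N - ∑ i, α i) h1
    rwa [Nat.add_sub_cancel' (mem_multi.1 hα)] at h2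
  obtain ⟨c, hc⟩ := exists_iter_invDeriv_mem_jetField hdet hsymm
    (Sum.elim y fun p : Fin m × Fin m => M p.1 p.2)
  refine le_of_forall_card_multi_le (q := 0) (K := 0) (c := c) hm fun N => ?_
  rw [zero_mul, zero_mul, add_zero, add_zero, add_zero]
  -- A transcendence basis of this field among the generators.
  obtain ⟨I, hI⟩ := (AlgebraicIndependent.matroid E G).exists_isBasis (Set.range (φ ∘ gen N))
  have hIind : AlgebraicIndependent E ((↑) : I → G) :=
    AlgebraicIndependent.matroid_indep_iff.1 hI.indep
  have hIfin : I.Finite := (Set.finite_range _).subset hI.subset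
  have hIcl : acl E I = acl E (Set.range (φ ∘ gen N)) := by
    refine SetLike.coe_injective ?_
    rw [coe_acl, coe_acl, hI.closure_eq_closure]
  have hIcard : m * (multi m N).card ≤ Nat.card I := by
    have h1 : AlgebraicIndependent E
        fun p : Fin m × multi m N => iter Δ (p.2.1 + Pi.single k₀ 1) (z p.1) :=
      hz.comp (fun p : Fin m × multi m N =>
        ((p.1, p.2.1 + Pi.single k₀ 1) : Fin m × (Fin m → ℕ))) fun p q hpq => by
          simp only [Prod.mk.injEq] at hpq
          exact Prod.ext hpq.1 (Subtype.ext (add_right_cancel hpq.2))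
    have h2 := card_le_of_algebraicIndependent h1 hIfin fun p => by
      rw [hIcl]
      exact adjoin_le_acl _ (hzmem N _ p.2.2 p.1)
    rw [Nat.card_coe_set_eq]
    simpa using h2
  have hw : ∀ v : I, ∃ p, φ (gen N p) = v := fun v => hI.subset v.2
  choose w hw using hw
  let _ : Algebra (CRat D n) E := (inclHom hD n).toAlgebra
  let _ : Algebra (CRat D n) G := ((algebraMap E G).comp (inclHom hD n)).toAlgebra
  let _ : Algebra (constField D) G :=
    ((algebraMap (CRat D n) G).comp (algebraMap (constField D) (CRat D n))).toAlgebra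
  have : IsScalarTower (CRat D n) E G := IsScalarTower.of_algebraMap_eq fun _ => rfl
  have : IsScalarTower (constField D) (CRat D n) G := IsScalarTower.of_algebraMap_eq fun _ => rfl
  have hIind' : AlgebraicIndependent (CRat D n) ((↑) : I → G) :=
    hIind.restrictScalars (inclHom hD n).injective
  have hyind : AlgebraicIndependent (constField D)
      fun p : Fin d × multi m N => iter δ p.2.1 (y p.1) :=
    hind.comp (fun p : Fin d × multi m N => ((p.1, p.2.1) : Fin d × (Fin m → ℕ)))
      fun p q hpq => by
        simp only [Prod.mk.injEq] at hpq
        exact Prod.ext hpq.1 (Subtype.ext hpq.2)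
  -- Independence in the tower C ⊆ C⟨x⟩ ⊆ G: the derivatives of y over C, then the basis I over
  -- C⟨x⟩.
  have hsum := hyind.sumElim_comp hIind'
  let φA : CRat D n →ₐ[constField D] G :=
    { φ with
      commutes' := fun c => hφinv _ fun g hg => by
        rw [substHom_algebraMap, inclHom_algebraMap] }
  -- Both blocks are φ-images, so independence pulls back along φ to functions in C⟨x⟩ of order at
  -- most N + c.
  have hcomp : Sum.elim ((↑) : I → G)
      (algebraMap (CRat D n) G ∘ fun p : Fin d × multi m N => iter δ p.2.1 (y p.1)) =
      φA ∘ Sum.elim (fun v : I => gen N (w v))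
        (fun p : Fin d × multi m N => iter δ p.2.1 (y p.1)) := by
    ext p
    rcases p with v | p
    · exact (hw v).symm
    · exact (hyfix p.1 p.2.1).symm
  rw [hcomp] at hsum
  have hfinal := card_le_of_mem_jetField (N := N + c) (AlgebraicIndependent.of_comp φA hsum)
    (fun p => by
      rcases p with v | p
      · exact hc N _ (w v).2.2.2 (Sum.inr ((w v).1, (w v).2.1))
      · exact hc N _ p.2.2 (Sum.inl p.1))
  have hfinI : Finite I := hIfin
  have hcard : Nat.card (multi m N) = (multi m N).card := by simp
  rw [Nat.card_sum, Nat.card_prod, Nat.card_fin, hcard] at hfinal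
  change Nat.card I + _ ≤ _ at hfinal
  linarith

end UpperBound

/-! ### The field of invariants and its elements obtained from linear relations. -/

section InvariantField

variable {F : Type*} [Field F] {m n : ℕ} {D : Fin m → Der F}

/-- The field of the functions that are invariant under `GL^∂(m, F)` and `H`. -/
def invField (hD : ∀ i j a, D i (D j a) = D j (D i a)) (H : Subgroup (GL (Fin n) (constField D))) :
    IntermediateField (constField D) (CRat D n) where
  carrier := {f | ∀ g, ∀ hg : g ∈ GLd D, ∀ h ∈ H, substHom hD hg h f = inclHom hD n f}
  mul_mem' ha hb g hg h hh := by rw [map_mul, map_mul, ha g hg h hh, hb g hg h hh]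
  one_mem' g hg h hh := by rw [map_one, map_one]
  add_mem' ha hb g hg h hh := by rw [map_add, map_add, ha g hg h hh, hb g hg h hh]
  zero_mem' g hg h hh := by rw [map_zero, map_zero]
  algebraMap_mem' c g hg h hh := by rw [substHom_algebraMap, inclHom_algebraMap]
  inv_mem' a ha g hg h hh := by rw [map_inv₀, map_inv₀, ha g hg h hh]

variable (hD : ∀ i j a, D i (D j a) = D j (D i a)) {H : Subgroup (GL (Fin n) (constField D))}
  {M : Matrix (Fin m) (Fin m) (CRat D n)}

theorem mem_invField {f : CRat D n} : f ∈ invField hD H ↔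
    ∀ g, ∀ hg : g ∈ GLd D, ∀ h ∈ H, substHom hD hg h f = inclHom hD n f := Iff.rfl

theorem mem_invField_iff {f : CRat D n} : f ∈ invField hD H ↔ IsInvariant D H f := by
  rw [mem_invField, IsInvariant]
  refine forall_congr' fun g => forall_congr' fun hg => forall_congr' fun h =>
    forall_congr' fun _ => ?_
  rw [ratSubst_eq_substHom hD hg, ratSubst_eq_inclHom hD]

theorem ratDeriv_substHom {g : GL (Fin m) F} (hg : g ∈ GLd D) (h : GL (Fin n) (constField D))
    (i : Fin m) (f : CRat D n) : ratDeriv D i (substHom hD hg h f) =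
      ∑ k, ((g : Matrix (Fin m) (Fin m) F).map (algebraMap F (DiffRat F n m))) i k *
        substHom hD hg h (cDeriv D n k f) := by
  rw [← gauge_gaugeInv g, gauge_apply]
  exact Finset.sum_congr rfl fun k _ => by rw [substHom_cDeriv]

theorem inclHom_invDeriv (hdet : M.det ≠ 0) (k : Fin m) (f : CRat D n) :
    inclHom hD n (invDeriv D M k f) =
      gauge (M.map (inclHom hD n))⁻¹ (ratDeriv D) k (inclHom hD n f) :=
  map_invDeriv (Z := 1) hdet (det_map_ne_zero _ hdet)
    (fun i f => by simp [Matrix.one_apply, inclHom_cDeriv]) (Matrix.one_mul _) k f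

/-- The matrix `M` transforms as `M ↦ g⁻¹M` under the substitutions by `GL^∂(m, F)` and `H`. -/
def IsFrame (hD : ∀ i j a, D i (D j a) = D j (D i a)) (H : Subgroup (GL (Fin n) (constField D)))
    (M : Matrix (Fin m) (Fin m) (CRat D n)) : Prop :=
  ∀ g, ∀ hg : g ∈ GLd D, ∀ h ∈ H,
    (g : Matrix (Fin m) (Fin m) F).map (algebraMap F (DiffRat F n m)) *
      M.map (substHom hD hg h) = M.map (inclHom hD n)

theorem substHom_invDeriv (hequiv : IsFrame hD H M) (hdet : M.det ≠ 0) {g : GL (Fin m) F} (hg : g ∈ GLd D)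
    {h : GL (Fin n) (constField D)} (hh : h ∈ H) (k : Fin m) (f : CRat D n) :
    substHom hD hg h (invDeriv D M k f) =
      gauge (M.map (inclHom hD n))⁻¹ (ratDeriv D) k (substHom hD hg h f) :=
  map_invDeriv hdet (det_map_ne_zero _ hdet) (ratDeriv_substHom hD hg h) (hequiv g hg h hh) k f

/-- Every admissible substitution and the inclusion intertwine δ with one and the same system on
F⟨x⟩. -/
theorem invDeriv_mem_invField (hequiv : IsFrame hD H M) (hdet : M.det ≠ 0) (k : Fin m) {f : CRat D n}
    (hf : f ∈ invField hD H) : invDeriv D M k f ∈ invField hD H := fun g hg h hh => by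
  rw [substHom_invDeriv hD hequiv hdet hg hh, hf g hg h hh, inclHom_invDeriv hD hdet]

/-- The derivatives `δ^α x` transform by the matrix `h`. -/
theorem substHom_iter_indet (hequiv : IsFrame hD H M) (hdet : M.det ≠ 0)
    {g : GL (Fin m) F} (hg : g ∈ GLd D)
    {h : GL (Fin n) (constField D)} (hh : h ∈ H) (α : Fin m → ℕ) (i : Fin n) :
    substHom hD hg h (iter (invDeriv D M) α (indet _ i)) =
      ∑ j, inclHom hD n (iter (invDeriv D M) α (indet _ j)) * algebraMap F _ (h j i : F) := by
  rw [map_iter (substHom hD hg h) (substHom_invDeriv hD hequiv hdet hg hh), substHom_indet,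
    rowMul_apply, map_sum]
  refine Finset.sum_congr rfl fun j _ => ?_
  rw [map_iter (inclHom hD n) (inclHom_invDeriv hD hdet), inclHom_indet]
  refine (map_iter (fun f => f * algebraMap F _ (h j i : F)) (fun k f => ?_) α _).symm
  have h0 : gauge (M.map (inclHom hD n))⁻¹ (ratDeriv D) k
      (algebraMap F (DiffRat F n m) (h j i : F)) = 0 := by
    rw [gauge_apply]
    refine Finset.sum_eq_zero fun l _ => ?_
    rw [ratDeriv_algebraMap, (h j i).2 l, map_zero, mul_zero]
  rw [Derivation.leibniz, h0, smul_zero, zero_add, smul_eq_mul, mul_comm]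

/-- Linear independence in the form of a matrix identity, which any ring homomorphism transports. -/
theorem exists_right_inverse_of_linearIndependent {L : Type*} [Field L] {r n : ℕ}
    {f : Fin r → Fin n → L} (hf : LinearIndependent L f) :
    ∃ V : Fin n → Fin r → L, ∀ k k', ∑ i, f k i * V i k' = if k = k' then 1 else 0 := by
  obtain ⟨g, hg⟩ := LinearMap.exists_leftInverse_of_injective (Fintype.linearCombination L f)
    (LinearMap.ker_eq_bot.2 hf.fintypeLinearCombination_injective)
  refine ⟨fun i => g (Pi.single i 1), fun k k' => ?_⟩
  have h1 := LinearMap.congr_fun hg (Pi.single k 1)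
  rw [LinearMap.comp_apply, Fintype.linearCombination_apply_single, one_smul,
    LinearMap.id_apply] at h1
  have h2 : g (f k) = ∑ i, f k i • g (Pi.single i 1) := by
    conv_lhs => rw [pi_eq_sum_univ' (f k), map_sum]
    simp only [map_smul]
  have h3 := congrFun h1 k'
  rw [h2, Finset.sum_apply, Pi.single_apply] at h3
  simpa [eq_comm] using h3

/-- The coefficients of a linear relation between the rows `δ^α x` are invariant. -/
theorem coeff_mem_invField (hequiv : IsFrame hD H M) (hdet : M.det ≠ 0) {r : ℕ}
    {β : Fin r → Fin m → ℕ}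
    (hβ : LinearIndependent (CRat D n) fun k i => iter (invDeriv D M) (β k) (indet _ i))
    {α : Fin m → ℕ} {c : Fin r → CRat D n}
    (hc : ∀ i, iter (invDeriv D M) α (indet _ i) =
      ∑ k, c k * iter (invDeriv D M) (β k) (indet _ i)) (k : Fin r) : c k ∈ invField hD H := by
  intro g hg h hh
  obtain ⟨V, hV⟩ := exists_right_inverse_of_linearIndependent hβ
  set φ := substHom hD hg h with hφ
  set ι := inclHom hD n with hι
  set R : (Fin m → ℕ) → Fin n → DiffRat F n m := fun α j =>
    ι (iter (invDeriv D M) α (indet _ j)) with hR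
  set A : Matrix (Fin n) (Fin n) (DiffRat F n m) :=
    (h : Matrix (Fin n) (Fin n) (constField D)).map
      ((algebraMap F (DiffRat F n m)).comp (constField D).subtype) with hA
  have hφR : ∀ α i, φ (iter (invDeriv D M) α (indet _ i)) = Matrix.vecMul (R α) A i :=
    fun α i => substHom_iter_indet hD hequiv hdet hg hh α i
  have hAinj : Function.Injective fun v => Matrix.vecMul v A := by
    have hAA : A * ((h⁻¹ : GL (Fin n) (constField D)) : Matrix (Fin n) (Fin n)
        (constField D)).map ((algebraMap F (DiffRat F n m)).comp (constField D).subtype) = 1 := by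
      rw [hA, ← Matrix.map_mul, ← Units.val_mul, mul_inv_cancel, Units.val_one,
        Matrix.map_one _ (map_zero _) (map_one _)]
    intro v w hvw
    have h1 := congrArg (fun u => Matrix.vecMul u (((h⁻¹ : GL (Fin n) (constField D)) :
      Matrix (Fin n) (Fin n) (constField D)).map
        ((algebraMap F (DiffRat F n m)).comp (constField D).subtype))) hvw
    simpa only [Matrix.vecMul_vecMul, hAA, Matrix.vecMul_one] using h1
  -- The substituted relation has all its rows multiplied by the invertible matrix A, which cancels.
  -- Comparison with the original relation `h2` gives φ(c_k) = ι(c_k), as coefficients are unique.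
  have h1 : R α = ∑ k, φ (c k) • R (β k) := by
    refine hAinj ?_
    ext i
    dsimp only
    rw [← hφR, hc, map_sum, Matrix.sum_vecMul, Finset.sum_apply]
    refine Finset.sum_congr rfl fun k _ => ?_
    rw [map_mul, hφR, Matrix.smul_vecMul, Pi.smul_apply, smul_eq_mul]
  have h2 : R α = ∑ k, ι (c k) • R (β k) := by
    ext i
    rw [hR]
    dsimp only
    rw [hc, map_sum, Finset.sum_apply]
    exact Finset.sum_congr rfl fun k _ => map_mul _ _ _
  have h3 : ∀ u : Fin r → DiffRat F n m,
      ∑ i, (∑ k, u k • R (β k)) i * ι (V i k) = u k := fun u => by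
    simp only [Finset.sum_apply, Pi.smul_apply, smul_eq_mul, Finset.sum_mul]
    rw [Finset.sum_comm]
    have h4 : ∀ k', ∑ i, u k' * R (β k') i * ι (V i k) = u k' * if k' = k then 1 else 0 := by
      intro k'
      have h5 := congrArg ι (hV k' k)
      rw [map_sum] at h5
      rw [show (if k' = k then (1 : DiffRat F n m) else 0) = ι (if k' = k then 1 else 0) by
        split_ifs <;> simp, ← h5, Finset.mul_sum]
      exact Finset.sum_congr rfl fun i _ => by rw [map_mul, mul_assoc]
    simp only [h4]
    simp
  rw [← h3 fun k => φ (c k), ← h1, h2, h3 fun k => ι (c k)]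

end InvariantField

/-! ### At least n - m independent invariants. -/

section LowerBound

theorem iter_add_single' {L : Type*} [Field L] {m : ℕ} {δ : Fin m → Der L}
    (hδ : ∀ i j a, δ i (δ j a) = δ j (δ i a)) (α : Fin m → ℕ) (k : Fin m) (a : L) :
    iter δ (α + Pi.single k 1) a = iter δ α (δ k a) := by
  rw [iter_add_single hδ, map_iter (δ k) (fun l a => hδ k l a)]

/-- The derivatives of order at most `N` of a matrix with closed columns: few of them are
distinct. -/
theorem ncard_iter_closed_le {L : Type*} [Field L] {m : ℕ} {d : Fin m → Der L}
    (hd : ∀ i j a, d i (d j a) = d j (d i a)) {M : Matrix (Fin m) (Fin m) L}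
    (hM : ∀ i j k, d k (M i j) = d i (M k j)) (N : ℕ) :
    (Set.range fun p : Fin m × Fin m × multi m N => iter d p.2.2.1 (M p.1 p.2.1)).ncard ≤
      m * (multi m (N + 1)).card := by
  classical
  -- By closedness, ∂^β M_ij depends only on j and β + e_i. `w` computes it from any nonzero entry
  -- of that index; its value 0 at the zero index is never needed.
  let w : Fin m × (Fin m → ℕ) → L := fun p =>
    if h : ∃ i, p.2 i ≠ 0 then iter d (p.2 - Pi.single h.choose 1) (M h.choose p.1) else 0
  have hw : ∀ β i j, iter d β (M i j) = w (j, β + Pi.single i 1) := by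
    intro β i j
    have hex : ∃ l, (β + Pi.single i 1 : Fin m → ℕ) l ≠ 0 := ⟨i, by simp⟩
    simp only [w]
    rw [dif_pos hex]
    set l := hex.choose with hl
    have hlne : (β + Pi.single i 1 : Fin m → ℕ) l ≠ 0 := hex.choose_spec
    by_cases hli : l = i
    · rw [hli, add_tsub_cancel_right]
    · have h0 : β l ≠ 0 := by simpa [hli] using hlne
      have h1 : β = β - Pi.single l 1 + Pi.single l 1 := by
        ext a
        by_cases ha : a = l
        · subst ha
          simp
          omega
        · simp [ha]
      have h2 : β + Pi.single i 1 - Pi.single l 1 = β - Pi.single l 1 + Pi.single i 1 := by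
        conv_lhs => rw [h1, add_right_comm, add_tsub_cancel_right]
      rw [h2, iter_add_single' hd, ← hM i j l, ← iter_add_single' hd, ← h1]
  have hsub : (Set.range fun p : Fin m × Fin m × multi m N => iter d p.2.2.1 (M p.1 p.2.1)) ⊆
      ((Finset.univ ×ˢ multi m (N + 1)).image w : Finset L) := by
    rintro _ ⟨⟨i, j, β⟩, rfl⟩
    rw [Finset.mem_coe, Finset.mem_image]
    exact ⟨(j, β.1 + Pi.single i 1),
      Finset.mem_product.2 ⟨Finset.mem_univ _, add_single_mem_multi β.2 i⟩, (hw _ _ _).symm⟩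
  refine (Set.ncard_le_ncard hsub (Finset.finite_toSet _)).trans ?_
  rw [Set.ncard_coe_finset]
  refine Finset.card_image_le.trans ?_
  rw [Finset.card_product, Finset.card_univ, Fintype.card_fin]

/-- Finitely many of the rows of an infinite matrix form a basis of the row space. -/
theorem exists_basis_of_rows {L ι : Type*} [Field L] {n : ℕ} (row : ι → Fin n → L) :
    ∃ (r : ℕ) (β : Fin r → ι), LinearIndependent L (fun k => row (β k)) ∧
      ∀ α, ∃ c : Fin r → L, ∀ i, row α i = ∑ k, c k * row (β k) i := by
  obtain ⟨W, hWmem, hWspan, hWind⟩ := Submodule.exists_fun_fin_finrank_span_eq L (Set.range row)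
  choose β hβ using hWmem
  refine ⟨_, β, (funext hβ : (fun k => row (β k)) = W) ▸ hWind, fun α => ?_⟩
  have h1 : row α ∈ Submodule.span L (Set.range W) := by
    rw [hWspan]
    exact Submodule.subset_span ⟨α, rfl⟩
  obtain ⟨c, hc⟩ := (Submodule.mem_span_range_iff_exists_fun _).1 h1
  refine ⟨c, fun i => ?_⟩
  rw [← hc, Finset.sum_apply]
  exact Finset.sum_congr rfl fun k _ => by rw [Pi.smul_apply, smul_eq_mul, hβ]

variable {F : Type*} [Field F] [CharZero F] {m n : ℕ} {D : Fin m → Der F}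
  {H : Subgroup (GL (Fin n) (constField D))} {M : Matrix (Fin m) (Fin m) (CRat D n)}

theorem charZero_cRat (D : Fin m → Der F) (n : ℕ) : CharZero (CRat D n) :=
  have : CharZero (constField D) :=
    ((constField D).subtype.charZero_iff (constField D).subtype_injective).2 inferInstance
  charZero_of_injective_algebraMap (algebraMap (constField D) (CRat D n)).injective

/-- There are `n - m` functions that are invariant and `δ`-algebraically independent. -/
theorem exists_diffAlgIndep_invField (hm : 0 < m) (hD : ∀ i j a, D i (D j a) = D j (D i a))
    (hdet : M.det ≠ 0) (hsymm : ∀ i j k, cDeriv D n k (M i j) = cDeriv D n i (M k j))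
    (hequiv : IsFrame hD H M) :
    ∃ (s : ℕ) (y : Fin s → CRat D n), n ≤ s + m ∧ (∀ i, y i ∈ invField hD H) ∧
      DiffAlgIndep (constField D) (invDeriv D M) y := by
  classical
  have := charZero_cRat D n
  set δ := invDeriv D M with hδdef
  have hδ : ∀ i j a, δ i (δ j a) = δ j (δ i a) := invDeriv_comm hdet hsymm
  set row : (Fin m → ℕ) → Fin n → CRat D n := fun α i => iter δ α (indet _ i) with hrow
  obtain ⟨r, β, hWind, hcoef⟩ := exists_basis_of_rows row
  choose c hc using hcoef
  have hcK : ∀ α k, c α k ∈ invField hD H := fun α k =>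
    coeff_mem_invField hD hequiv hdet hWind (hc α) k
  -- The coefficients of x itself and of the first δ-derivatives of the basis rows determine the
  -- whole module of rows.
  let a : Fin r ⊕ (Fin m × Fin r × Fin r) → CRat D n :=
    Sum.elim (c 0) fun p => c (β p.2.1 + Pi.single p.1 1) p.2.2
  have haK : ∀ i, a i ∈ invField hD H := by
    rintro (k | p)
    · exact hcK _ _
    · exact hcK _ _
  obtain ⟨S, e, hS, hgrowth⟩ := exists_diffAlgIndep_growth (k := constField D) hδ
    (invDeriv_algebraMap M) a
  refine ⟨S.card, fun i => a (S.equivFin.symm i), ?_, fun i => haK _, ?_⟩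
  swap
  · exact AlgebraicIndependent.comp hS
      (fun p : Fin S.card × (Fin m → ℕ) => (S.equivFin.symm p.1, p.2)) fun p q hpq => by
        simp only [Prod.mk.injEq, EmbeddingLike.apply_eq_iff_eq] at hpq
        exact Prod.ext hpq.1 hpq.2
  let Y : ℕ → Set (CRat D n) := fun N =>
    Set.range fun p : Fin m × Fin m × multi m N => iter (cDeriv D n) p.2.2.1 (M p.1 p.2.1)
  let Wset : Set (CRat D n) := Set.range fun p : Fin r × Fin n => row (β p.1) p.2
  let A : ℕ → Set (CRat D n) := fun N =>
    Set.range fun p : (Fin r ⊕ (Fin m × Fin r × Fin r)) × multi m N => iter δ p.2.1 (a p.1)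
  let T : ℕ → IntermediateField (constField D) (CRat D n) := fun N =>
    IntermediateField.adjoin (constField D) (A N ∪ Wset ∪ Y N)
  have hAmem : ∀ N, ∀ α ∈ multi m N, ∀ i, iter δ α (a i) ∈ T N := fun N α hα i =>
    IntermediateField.subset_adjoin _ _ (Or.inl (Or.inl ⟨(i, ⟨α, hα⟩), rfl⟩))
  have hWmem : ∀ N k i, row (β k) i ∈ T N := fun N k i =>
    IntermediateField.subset_adjoin _ _ (Or.inl (Or.inr ⟨(k, i), rfl⟩))
  have hYmem : ∀ N, ∀ α ∈ multi m N, ∀ i j, iter (cDeriv D n) α (M i j) ∈ T N :=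
    fun N α hα i j => IntermediateField.subset_adjoin _ _ (Or.inr ⟨(i, j, ⟨α, hα⟩), rfl⟩)
  have hmono : ∀ {N N'}, N ≤ N' → T N ≤ T N' := fun {N N'} hN => by
    refine IntermediateField.adjoin_le_iff.2 ?_
    rintro _ ((⟨⟨i, α⟩, rfl⟩ | ⟨⟨k, i⟩, rfl⟩) | ⟨⟨i, j, α⟩, rfl⟩)
    · exact hAmem _ _ (multi_mono hN α.2) _
    · exact hWmem _ _ _
    · exact hYmem _ _ (multi_mono hN α.2) _ _
  have hzero : ∀ N, (0 : Fin m → ℕ) ∈ multi m N := fun N => by simp [mem_multi]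
  have hMmem : ∀ N i j, M i j ∈ T N := fun N i j => by
    have := hYmem N 0 (hzero N) i j
    rwa [iter_zero] at this
  have hamem : ∀ N i, a i ∈ T N := fun N i => by
    have := hAmem N 0 (hzero N) i
    rwa [iter_zero] at this
  have hcd : ∀ N k f, (∀ l, δ l f ∈ T N) → cDeriv D n k f ∈ T N := fun N k f hf => by
    rw [cDeriv_eq_sum hdet]
    exact sum_mem fun l _ => mul_mem (hMmem _ _ _) (hf l)
  -- On derivatives of a and on basis rows, ∂ = Mδ is used: δ raises the order on a and expands the
  -- rows by means of a. On the derivatives of M, ∂ acts directly.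
  have hstep : ∀ N, 0 ≤ N → ∀ k, ∀ f ∈ (T N : Set (CRat D n)),
      cDeriv D n k f ∈ (T (N + 1) : Set (CRat D n)) := fun N _ k f hf => by
    refine deriv_mem_of_mem_adjoin (cDeriv D n k) (fun c => ?_)
      ((IntermediateField.subset_adjoin _ _).trans (hmono (Nat.le_succ N))) ?_ hf
    · rw [cDeriv_algebraMap]
      exact zero_mem _
    · rintro _ ((⟨⟨i, α⟩, rfl⟩ | ⟨⟨k', i⟩, rfl⟩) | ⟨⟨i, j, α⟩, rfl⟩)
      · refine hcd _ _ _ fun l => ?_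
        dsimp only
        rw [← iter_add_single hδ]
        exact hAmem _ _ (add_single_mem_multi α.2 l) _
      · refine hcd _ _ _ fun l => ?_
        have h1 : δ l (row (β k') i) = row (β k' + Pi.single l 1) i :=
          (iter_add_single hδ _ _ _).symm
        dsimp only
        rw [h1, hc]
        exact sum_mem fun k'' _ => mul_mem (hamem _ (Sum.inr (l, k', k''))) (hWmem _ _ _)
      · dsimp only
        rw [← iter_add_single cDeriv_comm]
        exact hYmem _ _ (add_single_mem_multi α.2 k) _ _
  have hjet : ∀ N, ∀ α ∈ multi m N, ∀ i, jet (constField D) i α ∈ T N := by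
    intro N α hα i
    have h1 : indet (constField D) i ∈ T 0 := by
      have h2 : indet (constField D) i = row 0 i := (iter_zero _ _).symm
      rw [h2, hc]
      exact sum_mem fun k _ => mul_mem (hamem _ (Sum.inl k)) (hWmem _ _ _)
    have h3 := iter_mem_of_filtration cDeriv_comm hstep h1 α
    rw [cDeriv, iter_ratDeriv_indet (fun _ _ _ => rfl), zero_add] at h3
    exact hmono (mem_multi.1 hα) h3
  -- q is the size of the family a, r·n bounds the number of entries of the basis rows, and 2e + 1
  -- dominates the shifts 2e, e and e + 1 that occur.
  refine le_of_forall_card_multi_le (q := Fintype.card (Fin r ⊕ (Fin m × Fin r × Fin r)))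
    (K := r * n) (c := 2 * e + 1) hm fun N => ?_
  obtain ⟨X, hXfin, hXcard, hX⟩ := hgrowth N
  have hYfin : (Y (N + e)).Finite := Set.finite_range _
  have hWfin : Wset.Finite := Set.finite_range _
  have hle : T (N + e) ≤ acl (constField D) (X ∪ Wset ∪ Y (N + e)) := by
    refine IntermediateField.adjoin_le_iff.2 ?_
    rintro _ ((⟨⟨i, α⟩, rfl⟩ | hx) | hx)
    · exact acl_mono (Set.subset_union_left.trans Set.subset_union_left) (hX i α.1 α.2)
    · exact subset_acl _ (Or.inl (Or.inr hx))
    · exact subset_acl _ (Or.inr hx)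
  have hjetind : AlgebraicIndependent (constField D)
      fun p : Fin n × multi m (N + e) => (jet (constField D) p.1 p.2.1 : CRat D n) :=
    algebraicIndependent_jet.comp
      (fun p : Fin n × multi m (N + e) => ((p.1, p.2.1) : Fin n × (Fin m → ℕ)))
      fun p q hpq => by
        simp only [Prod.mk.injEq] at hpq
        exact Prod.ext hpq.1 (Subtype.ext hpq.2)
  have h1 := card_le_of_algebraicIndependent hjetind ((hXfin.union hWfin).union hYfin)
    fun p => hle (hjet _ _ p.2.2 p.1)
  have hcard : Nat.card (Fin n × multi m (N + e)) = n * (multi m (N + e)).card := by simp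
  rw [hcard] at h1
  have h2 : Wset.ncard ≤ r * n := by
    rw [← Nat.card_coe_set_eq]
    refine (Finite.card_range_le _).trans ?_
    simp
  have h3 : (Y (N + e)).ncard ≤ m * (multi m (N + e + 1)).card :=
    ncard_iter_closed_le cDeriv_comm hsymm (N + e)
  have h4 := (Set.ncard_union_le (X ∪ Wset) (Y (N + e))).trans
    (Nat.add_le_add_right (Set.ncard_union_le X Wset) _)
  have hB : ∀ {a b}, a ≤ b → (multi m a).card ≤ (multi m b).card := fun h =>
    Finset.card_le_card (multi_mono h)
  have h5 := Nat.mul_le_mul_left n (hB (show N ≤ N + e by omega))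
  have h6 := Nat.mul_le_mul_left S.card (hB (show N + 2 * e ≤ N + (2 * e + 1) by omega))
  have h7 := Nat.mul_le_mul_left (Fintype.card (Fin r ⊕ (Fin m × Fin r × Fin r)))
    (hB (show N + e ≤ N + (2 * e + 1) by omega))
  have h8 := Nat.mul_le_mul_left m (hB (show N + e + 1 ≤ N + (2 * e + 1) by omega))
  rw [add_mul]
  linarith

end LowerBound

/-! ### From finite families to the differential transcendence degree. -/

section Degree

theorem DiffAlgIndep.injective {k L ι : Type*} [Field k] [Field L] [Algebra k L] {m : ℕ}
    {δ : Fin m → Der L} {y : ι → L} (hy : DiffAlgIndep k δ y) : Function.Injective y := by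
  intro i j hij
  have h1 := AlgebraicIndependent.injective hy (a₁ := (i, 0)) (a₂ := (j, 0))
    (by simp only [iter_zero, hij])
  exact (Prod.mk.inj h1).1

/-- Finite families suffice: an independent set of cardinality above d, even an infinite one,
contains d + 1 independent elements. -/
theorem diffTrdeg_eq_natCast {k : Type*} {L : Type u} [Field k] [Field L] [Algebra k L] {m : ℕ}
    {δ : Fin m → Der L} {K : IntermediateField k L} {d : ℕ}
    (hle : ∀ (s : ℕ) (y : Fin s → L), (∀ i, y i ∈ K) → DiffAlgIndep k δ y → s ≤ d)
    {s : ℕ} {y : Fin s → L} (hyK : ∀ i, y i ∈ K) (hy : DiffAlgIndep k δ y) (hds : d ≤ s) :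
    diffTrdeg k δ K = (d : Cardinal) := by
  refine le_antisymm (ciSup_le' fun t => ?_) ?_
  · by_contra! hlt
    have h1 : ((d + 1 : ℕ) : Cardinal) ≤ Cardinal.mk t.1 := by
      rw [Nat.cast_add_one, ← Cardinal.succ_natCast]
      exact Order.succ_le_of_lt hlt
    rw [← Cardinal.lift_natCast.{u, 0}, ← Cardinal.mk_fin,
      ← Cardinal.lift_id'.{0, u} (Cardinal.mk t.1),
      Cardinal.lift_mk_le'] at h1
    obtain ⟨f⟩ := h1
    have h2 := hle (d + 1) (fun i => (f i : L)) (fun i => t.2.1 (f i).2)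
      (AlgebraicIndependent.comp t.2.2
        (fun p : Fin (d + 1) × (Fin m → ℕ) => (f p.1, p.2)) fun p q hpq => by
          simp only [Prod.mk.injEq, EmbeddingLike.apply_eq_iff_eq] at hpq
          exact Prod.ext hpq.1 hpq.2)
    omega
  · have hinj := hy.injective
    have hset : DiffAlgIndep k δ (fun a : Set.range y => (a : L)) := by
      have h1 := AlgebraicIndependent.comp hy
        (fun p : Set.range y × (Fin m → ℕ) => ((Equiv.ofInjective y hinj).symm p.1, p.2))
        fun p q hpq => by
          simp only [Prod.mk.injEq, EmbeddingLike.apply_eq_iff_eq] at hpq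
          exact Prod.ext hpq.1 hpq.2
      have h2 : ((fun p : Fin s × (Fin m → ℕ) => iter δ p.2 (y p.1)) ∘
          fun p : Set.range y × (Fin m → ℕ) => ((Equiv.ofInjective y hinj).symm p.1, p.2)) =
          fun p : Set.range y × (Fin m → ℕ) => iter δ p.2 (p.1 : L) := by
        ext p
        simp only [Function.comp]
        rw [Equiv.apply_ofInjective_symm hinj]
      rw [h2] at h1
      exact h1
    refine le_trans ?_ (le_ciSup Cardinal.bddAbove_of_small
      (⟨Set.range y, by rintro _ ⟨i, rfl⟩; exact hyK i, hset⟩ :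
        {s : Set L // s ⊆ (K : Set L) ∧ DiffAlgIndep k δ (fun a : s => (a : L))}))
    have h3 : Cardinal.mk (Set.range y) = (s : Cardinal) := by
      have := Cardinal.mk_range_eq_of_injective hinj
      rw [Cardinal.mk_fin, Cardinal.lift_natCast] at this
      rw [← Cardinal.lift_id'.{0, u} (Cardinal.mk (Set.range y)), ← this]
    dsimp only
    rw [h3]
    exact_mod_cast hds

end Degree

end

end DiffInv

theorem theorem3p1 {F : Type*} [Field F] [CharZero F] (n m : ℕ) (hm : 0 < m)
    (D : Fin m → DiffInv.Der F)
    (hcomm : ∀ i j a, D i (D j a) = D j (D i a))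
    (hlin : LinearIndependent F D)
    (H : Subgroup (GL (Fin n) (DiffInv.constField D)))
    (M : Matrix (Fin m) (Fin m) (DiffInv.CRat D n))
    (hdet : M.det ≠ 0)
    (hsymm : ∀ i j k, DiffInv.cDeriv D n k (M i j) = DiffInv.cDeriv D n i (M k j))
    (hequiv : ∀ g ∈ DiffInv.GLd D, ∀ h ∈ H,
      M.map (DiffInv.ratSubst D (DiffInv.gaugeInv D n g) (DiffInv.rowMul D h)) =
        ((g⁻¹ : GL (Fin m) F) : Matrix (Fin m) (Fin m) F).map
            (algebraMap F (DiffInv.DiffRat F n m)) *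
          M.map (DiffInv.ratSubst D (DiffInv.ratDeriv D) (DiffInv.indet F))) :
    (∀ i j f, DiffInv.invDeriv D M i (DiffInv.invDeriv D M j f) =
      DiffInv.invDeriv D M j (DiffInv.invDeriv D M i f)) ∧
    ∃ K : IntermediateField (DiffInv.constField D) (DiffInv.CRat D n),
      (∀ f, f ∈ K ↔ DiffInv.IsInvariant D H f) ∧
      (∀ i, ∀ f ∈ K, DiffInv.invDeriv D M i f ∈ K) ∧
      m ≤ n ∧
      DiffInv.diffTrdeg (DiffInv.constField D) (DiffInv.invDeriv D M) K =
        ((n - m : ℕ) : Cardinal) := by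
  -- Equivariance is multiplied by g, so that no inverse of g remains.
  have hframe : DiffInv.IsFrame hcomm H M := fun g hg h hh => by
    have h1 := hequiv g hg h hh
    rw [funext (DiffInv.ratSubst_eq_substHom hcomm hg h),
      funext (DiffInv.ratSubst_eq_inclHom hcomm), DiffInv.map_inv_eq] at h1
    rw [h1, Matrix.mul_nonsing_inv_cancel_left _ _
      (isUnit_iff_ne_zero.2 (DiffInv.det_map_ne_zero _ (DiffInv.det_GL_ne_zero g)))]
  -- Only h = 1 is needed here: the bound already holds for invariance under GL^∂(m, F).
  have hupper : ∀ (s : ℕ) (y : Fin s → DiffInv.CRat D n),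
      (∀ i, y i ∈ DiffInv.invField hcomm H) →
      DiffInv.DiffAlgIndep (DiffInv.constField D) (DiffInv.invDeriv D M) y → s + m ≤ n :=
    fun s y hyK hy => DiffInv.add_le_of_diffAlgIndep hm hcomm hlin hdet hsymm
      (fun g hg => hframe g hg 1 H.one_mem) (fun j g hg => hyK j g hg 1 H.one_mem) hy
  obtain ⟨s, y, hs, hyK, hy⟩ := DiffInv.exists_diffAlgIndep_invField hm hcomm hdet hsymm hframe
  refine ⟨DiffInv.invDeriv_comm hdet hsymm, DiffInv.invField hcomm H,
    fun f => DiffInv.mem_invField_iff hcomm,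
    fun i f hf => DiffInv.invDeriv_mem_invField hcomm hframe hdet i hf,
    le_trans (Nat.le_add_left m s) (hupper s y hyK hy),
    DiffInv.diffTrdeg_eq_natCast (fun s y hyK hy => ?_) hyK hy (by omega)⟩
  have := hupper s y hyK hy
  omega
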